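/- **Notation.** $\log$ is the binary and $\ln$ the natural logarithm. For $r>0$, $0\le p<1$ let $\mathrm{NB}(r,p)$ be the law on $\mathbb Z_{\ge0}$ with mass $\frac{r(r+1)\cdots(r+k-1)}{k!}(1-p)^r p^k$ at $k$. For $x\in\{0,1\}^d$ let $\|x\|_1$ be its number of ones; for $D=(x_1,\dots,x_n)\in(\{0,1\}^d)^n$ let $\mathrm{Max}_{\ell_2}(D)=\max_i\|x_i\|_2$. Let $m=\lceil\log d\rceil$. A vector $x$ is of class $0$ if $\|x\|_1=1$, and of class $j\in\{1,\dots,m\}$ if $2^{j-1}+1\le\|x\|_1\le 2^j$. **BaseSumDP** on $\{0,1\}$, with parameters $\varepsilon,\delta,n$ and $\lambda=0.1$: a user with input $b\in\{0,1\}$ draws independently $a_+,a_-\sim\mathrm{NB}(1/n,e^{-(1-\lambda)\varepsilon})$ and $c\sim\mathrm{NB}(3(1+\ln(1/\delta))/n,e^{-0.2\lambda\varepsilon})$ and sends $b+a_++c$ messages $+1$ and $a_-+c$ messages $-1$. The analyzer adds up all received messages. **SparVecSumDP** (one round, $n$ users, parameters $\varepsilon,\delta,\beta$). User $i$ with $x_i\in\{0,1\}^d$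 runs independently, for every $j\in\{0,\dots,m\}$, one BaseSumDP instance with parameters $\varepsilon/2,\delta/2,n$ on the input $\mathbf 1[x_i\text{ is of class }j]$ and, for every $k\in\{1,\dots,d\}$, one BaseSumDP instance with parameters $\varepsilon'=\varepsilon/\big(2\sqrt{2^{j+1}\log(2/\delta)}\big)$, $\delta'=\delta/2^{j+1}$, $n$ on the input $x_i^k\cdot\mathbf 1[x_i\text{ is of class }j]$. Every message is tagged with its instance. All users use independent randomness, and the analyzer receives the multiset union of all messages. It computes the noisy counts $\widetilde{\mathrm{Count}}_j$ and the noisy sums $\widetilde{\mathrm{Sum}}_j^k$ of all instances, sets $\tau=2^j$ for the last $j$ with $\widetilde{\mathrm{Count}}_j>1.3\cdot\frac2\varepsilon\cdot\log(2(m+1)/\beta)$ (and $\tau=0$ if there is none), and outputs the vector with coordinates $\sum_{j:\,2^j\le\tau}\widetilde{\mathrm{Sum}}_j^k$, $k=1,\dots,d$. **Theorem.** There is an absolute constant $C>0$ such that for all integers $n\ge1$, $d\ge2$ and all reals $\varepsilon>0$ and $0<\delta\le\frac12$: 1. If $\varepsilon\le10$, the multiset of messages received by the analyzer is $(\varepsilon,\delta)$-differentially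 private for data sets that differ by the removal of the data of one user (who then holds the zero vector, which is of no class), and it is $(2\varepsilon,2\delta)$-differentially private for data sets that differ by an arbitrary replacement of the data of one user. 2. For every $\beta\in(0,1)$ and every $D\in(\{0,1\}^d)^n$, with probability at least $1-\beta$ the output $y$ satisfies $$\Big\|y-\sum_i x_i\Big\|_\infty\le C\cdot\frac{\big(\mathrm{Max}_{\ell_2}(D)\sqrt{\log(1/\delta)}+\log\log d\big)\cdot\log(d/\beta)}{\varepsilon}.$$ 3. A user with data $x\in\{0,1\}^d$ sends in expectation at most $$\|x\|_1+1+C\cdot\frac{d^{1.5}\,\log d\,\log^{1.5}(1/\delta)}{\varepsilon n}$$ messages, and all possible messages can be encoded injectively by bit strings of one common length at most $C\log d$. -/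

import Mathlib

open scoped ENNReal

noncomputable section

namespace SparVec

/-! ### The negative binomial distribution -/

/-- `NB(r, p)` puts mass `r (r+1) ⋯ (r+k-1) / k! * (1-p)^r * p^k` on `k`. -/
def negBinWeight (r p : ℝ) (k : ℕ) : ℝ :=
  (∏ i ∈ Finset.range k, (r + i)) / (k.factorial : ℝ) * (1 - p) ^ r * p ^ k

theorem negBinWeight_nonneg {r p : ℝ} (hr : 0 < r) (hp : 0 ≤ p) (hp1 : p < 1) (k : ℕ) :
    0 ≤ negBinWeight r p k := by
  have : 0 < 1 - p := by linarith
  unfold negBinWeight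
  have h : 0 ≤ ∏ i ∈ Finset.range k, (r + i) := Finset.prod_nonneg fun i _ => by positivity
  positivity

theorem choose_eq_prod (r : ℝ) (k : ℕ) :
    Ring.choose (r + k - 1) k = (∏ i ∈ Finset.range k, (r + i)) / (k.factorial : ℝ) := by
  have h1 : Ring.choose (r + k - 1) k = Ring.multichoose r k := by
    rw [Ring.choose]; congr 1; ring
  have h2 := Ring.factorial_nsmul_multichoose_eq_ascPochhammer r k
  have h3 : ∀ m : ℕ, (ascPochhammer ℝ m).eval r = ∏ i ∈ Finset.range m, (r + i) := by
    intro m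
    induction m with
    | zero => simp
    | succ m ih => rw [ascPochhammer_succ_eval, ih, Finset.prod_range_succ]
  rw [h1, eq_div_iff (by positivity), ← h3, ← Polynomial.ascPochhammer_smeval_eq_eval, ← h2]
  simp [mul_comm]

theorem hasSum_negBinWeight {r p : ℝ} (hp : 0 ≤ p) (hp1 : p < 1) :
    HasSum (negBinWeight r p) 1 := by
  have hb := Real.one_div_one_sub_rpow_hasFPowerSeriesOnBall_zero r
  have hmem : p ∈ Metric.eball (0 : ℝ) 1 := by
    simp [enorm_eq_nnnorm, Real.nnnorm_of_nonneg hp]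
    exact hp1
  have hs := hb.hasSum hmem
  simp only [FormalMultilinearSeries.ofScalars_apply_eq, zero_add, smul_eq_mul] at hs
  have hpos : (0 : ℝ) < (1 - p) ^ r := Real.rpow_pos_of_pos (by linarith) r
  have := hs.mul_right ((1 - p) ^ r)
  rw [one_div, inv_mul_cancel₀ hpos.ne'] at this
  refine this.congr_fun ?_
  intro k
  rw [choose_eq_prod, negBinWeight]; ring

theorem hasSum_ofReal_negBinWeight {r p : ℝ} (h : 0 < r ∧ 0 ≤ p ∧ p < 1) :
    HasSum (fun k => ENNReal.ofReal (negBinWeight r p k)) 1 := by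
  have hs := hasSum_negBinWeight (r := r) h.2.1 h.2.2
  have := ENNReal.ofReal_tsum_of_nonneg
    (fun k => negBinWeight_nonneg h.1 h.2.1 h.2.2 k) hs.summable
  rw [hs.tsum_eq, ENNReal.ofReal_one] at this
  rw [this]
  exact ENNReal.summable.hasSum

/-- The distribution `NB(r, p)` for parameters in the valid range. -/
def negBinOfValid {r p : ℝ} (h : 0 < r ∧ 0 ≤ p ∧ p < 1) : PMF ℕ :=
  ⟨fun k => ENNReal.ofReal (negBinWeight r p k), hasSum_ofReal_negBinWeight h⟩

open Classical in
/-- The negative binomial distribution `NB(r, p)` for real `r > 0` and `0 ≤ p < 1`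
(the protocol only uses parameters in this range; elsewhere the value is a dummy). -/
def negBin (r p : ℝ) : PMF ℕ :=
  if h : 0 < r ∧ 0 ≤ p ∧ p < 1 then negBinOfValid h else PMF.pure 0

theorem negBin_apply {r p : ℝ} (h : 0 < r ∧ 0 ≤ p ∧ p < 1) (k : ℕ) :
    negBin r p k = ENNReal.ofReal (negBinWeight r p k) := by
  rw [negBin, dif_pos h]; rfl

/-! ### The shuffle model -/

/-- The law of the multiset union of independent random multisets of messages. -/
def unionIndep {Z : Type} : List (PMF (Multiset Z)) → PMF (Multiset Z)
  | [] => PMF.pure 0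
  | P :: Ps => P.bind fun s => (unionIndep Ps).map fun t => s + t

/-- What the analyzer receives: the multiset union of the messages of all users, who apply the
local randomizer `R` independently. -/
def shuffledView {X Z : Type} {n : ℕ} (R : X → PMF (Multiset Z)) (D : Fin n → X) :
    PMF (Multiset Z) :=
  unionIndep (List.ofFn fun i => R (D i))

/-- `(ε, δ)`-differential privacy of a mechanism `M` with respect to a neighbouring relation. -/
def IsDP {I Y : Type} (neighbour : I → I → Prop) (M : I → PMF Y) (ε δ : ℝ) : Prop :=
  ∀ D D' : I, neighbour D D' → ∀ S : Set Y,
    (M D).toOuterMeasure S ≤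
      ENNReal.ofReal (Real.exp ε) * (M D').toOuterMeasure S + ENNReal.ofReal δ

/-- The expected number of messages in a random multiset. -/
def expectedMessages {Z : Type} (P : PMF (Multiset Z)) : ℝ≥0∞ :=
  ∑' s : Multiset Z, P s * (Multiset.card s : ℝ≥0∞)

/-! ### `BaseSumDP` on the domain `{0, 1}`

For domain size `U = 1` there is no randomized rounding, and all messages are `1` or `-1`. -/

/-- The local randomizer of `BaseSumDP` for `n` users and `U = 1` with privacy parameters `ε, δ`
and splitting parameter `lam`. A user sends the message `1` if the input is `1`, and adds
`a + c` copies of `1` and `b + c` copies of `-1`. Over all users, the `a` and `b` parts add up to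
a discrete Laplace variable with ratio `exp (-(1 - lam) * ε)`, and the `c` parts are cancelling
pairs with total number `NB (3 * (1 + ln (1/δ)), exp (-0.2 * lam * ε))`. -/
def baseSumRandomizer (n : ℕ) (ε δ lam : ℝ) (x : Bool) : PMF (Multiset ℤˣ) :=
  (negBin (1 / n) (Real.exp (-((1 - lam) * ε)))).bind fun a =>
  (negBin (1 / n) (Real.exp (-((1 - lam) * ε)))).bind fun b =>
  (negBin (3 * (1 + Real.log (1 / δ)) / n) (Real.exp (-(0.2 * (lam * ε))))).bind fun c =>
  PMF.pure (Multiset.replicate x.toNat 1 + Multiset.replicate (a + c) 1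
    + Multiset.replicate (b + c) (-1))

/-- The analyzer of `BaseSumDP` for `U = 1`: the sum of all messages. -/
def baseSumAnalyzer (R : Multiset ℤˣ) : ℤ :=
  (R.map fun y => (y : ℤ)).sum

/-! ### `SparVecSumDP` -/

/-- A data vector in `{0,1}^d`. -/
abbrev BinVec (d : ℕ) : Type := Fin d → Bool

/-- `‖x‖₁`, the number of ones. -/
def sparsity {d : ℕ} (x : BinVec d) : ℕ := ∑ k, (x k).toNat

/-- `x` as a vector of the Euclidean space. -/
def toEuclidean {d : ℕ} (x : BinVec d) : EuclideanSpace ℝ (Fin d) :=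
  WithLp.toLp 2 fun k => ((x k).toNat : ℝ)

/-- `Max_{ℓ₂}(D)`, the largest Euclidean norm of a data vector. -/
def maxL2 {n d : ℕ} (D : Fin n → BinVec d) : ℝ := ⨆ i, ‖toEuclidean (D i)‖

/-- Sparsity classes are indexed by `j = 0, …, ⌈log₂ d⌉`. -/
abbrev Level (d : ℕ) : Type := Fin (Nat.clog 2 d + 1)

/-- `x` has sparsity in `[2^(j-1) + 1, 2^j]` (for `j = 0`: sparsity `1`). -/
def inClass {d : ℕ} (j : ℕ) (x : BinVec d) : Bool :=
  decide (2 ^ j < 2 * sparsity x ∧ sparsity x ≤ 2 ^ j)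

/-- The `BaseSumDP` instances: `(j, none)` counts the vectors of class `j`, and `(j, some k)` sums
the `k`-th coordinate over the vectors of class `j`. -/
abbrev Instance (d : ℕ) : Type := Level d × Option (Fin d)

/-- A message of `BaseSumDP` together with the instance to which it belongs. -/
abbrev Message (d : ℕ) : Type := Instance d × ℤˣ

/-- All instances, listed. -/
def allInstances (d : ℕ) : List (Instance d) :=
  (List.finRange (Nat.clog 2 d + 1)).flatMap fun j =>
    (j, none) :: (List.finRange d).map fun k => (j, some k)

/-- `ε' = ε / (2 √(2^(j+1) log₂ (2/δ)))`. -/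
def coordEps (ε δ : ℝ) (j : ℕ) : ℝ :=
  ε / (2 * Real.sqrt (2 ^ (j + 1) * Real.logb 2 (2 / δ)))

/-- `δ' = δ / 2^(j+1)`. -/
def coordDelta (δ : ℝ) (j : ℕ) : ℝ := δ / 2 ^ (j + 1)

/-- The messages that a user with data `x` sends for one instance, before tagging; `BaseSumDP` is
used with `lam = 0.1`. -/
def instanceRandomizer (n d : ℕ) (ε δ : ℝ) (x : BinVec d) : Instance d → PMF (Multiset ℤˣ)
  | (j, none) => baseSumRandomizer n (ε / 2) (δ / 2) 0.1 (inClass j x)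
  | (j, some k) =>
      baseSumRandomizer n (coordEps ε δ j) (coordDelta δ j) 0.1 (x k && inClass j x)

/-- The local randomizer of `SparVecSumDP`: run all instances independently and send all their
messages, each tagged with its instance. -/
def sparVecRandomizer (n d : ℕ) (ε δ : ℝ) (x : BinVec d) : PMF (Multiset (Message d)) :=
  unionIndep ((allInstances d).map fun t =>
    (instanceRandomizer n d ε δ x t).map fun s => s.map fun y => (t, y))

/-- The (untagged) received messages of one instance. -/
def instanceMessages {d : ℕ} (R : Multiset (Message d)) (t : Instance d) : Multiset ℤˣ :=
  (R.filter fun z => z.1 = t).map Prod.snd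

/-- The noisy count of class `j`. -/
def noisyCount {d : ℕ} (R : Multiset (Message d)) (j : Level d) : ℤ :=
  baseSumAnalyzer (instanceMessages R (j, none))

/-- The noisy sum of coordinate `k` over class `j`. -/
def noisySum {d : ℕ} (R : Multiset (Message d)) (j : Level d) (k : Fin d) : ℤ :=
  baseSumAnalyzer (instanceMessages R (j, some k))

/-- The threshold that a noisy count has to exceed. -/
def countThreshold (d : ℕ) (ε β : ℝ) : ℝ :=
  1.3 * (2 / ε) * Real.logb 2 (2 * ((Nat.clog 2 d : ℝ) + 1) / β)

open Classical in
/-- `τ = 2^j` for the last `j` whose noisy count exceeds the threshold, and `τ = 0` if there is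
none. -/
def selectTau {d : ℕ} (ε β : ℝ) (R : Multiset (Message d)) : ℕ :=
  (List.finRange (Nat.clog 2 d + 1)).foldl
    (fun τ j => if countThreshold d ε β < (noisyCount R j : ℝ) then 2 ^ (j : ℕ) else τ) 0

/-- The analyzer of `SparVecSumDP`: add the noisy sums of all classes `j` with `2^j ≤ τ`. -/
def sparVecAnalyzer {d : ℕ} (ε β : ℝ) (R : Multiset (Message d)) (k : Fin d) : ℤ :=
  ∑ j : Level d, if 2 ^ (j : ℕ) ≤ selectTau ε β R then noisySum R j k else 0

/-- The messages that the analyzer of `SparVecSumDP` receives. -/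
def sparVecView (n d : ℕ) (ε δ : ℝ) (D : Fin n → BinVec d) : PMF (Multiset (Message d)) :=
  shuffledView (sparVecRandomizer n d ε δ) D

/-- The output distribution of `SparVecSumDP`. -/
def sparVecSumDP (n d : ℕ) (ε δ β : ℝ) (D : Fin n → BinVec d) : PMF (Fin d → ℤ) :=
  (sparVecView n d ε δ D).map (sparVecAnalyzer ε β)

/-- The data of one user is removed: one of `D`, `D'` arises from the other by deleting the
element of one user, who then holds the zero vector, which belongs to no sparsity class. -/
def RemoveNeighbour {n d : ℕ} (D D' : Fin n → BinVec d) : Prop :=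
  ∃ i, D' = Function.update D i (fun _ => false) ∨ D = Function.update D' i (fun _ => false)

/-- The data of one user is replaced by arbitrary data. -/
def ReplaceNeighbour {n d : ℕ} (D D' : Fin n → BinVec d) : Prop :=
  ∃ i x, D' = Function.update D i x

end SparVec

end

noncomputable section

namespace SparVec

/-! ### Convolution of laws on a commutative monoid -/

/-! Laws on a commutative monoid form a commutative monoid under convolution, and the analyzer's
view is a product in it over users and instances. Swapping the two products lets the noise of each
instance be added over all users. Since NB(r,p)*NB(s,p) = NB(r+s,p) (Vandermonde), an instance with
true sum B shows B+a+c messages +1 and b+c messages -1, where a and b are geometric and c ~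
NB(3(1+ln(1/δ)), e^{-0.02ε}) in the instance's own parameters (`sparVecView_eq`). The data enter
only through the sums B.

Privacy of one instance (`indist_baseNoise`): raising B by one either moves a, at a cost e^{0.9ε},
or is compensated by c → c+1 together with b → b-1, at a cost e^{0.9ε}·e^{0.1ε}. The latter works
unless c is small, an event of probability at most δ/20 by a Chernoff bound. Hence two laws with
neighbouring sums contain subdensities of equal mass at least 1-δ/20 whose pointwise ratios lie in
[e^{-ε}, e^ε] (`Indist`).

Composition: a nonzero vector affects one count, which costs ε/2, and at most 2^j coordinates of its
class j, whose squared parameters add up to at most ε²/(8 log(2/δ)) for every j. The coordinates are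
composed through Rényi moments. For a pair with ratios in [e^{-a}, e^a], the sum of P(P/Q)^α is at
most the value for randomized response, hence at most exp(α(α+1)a²/2). This is carried through the
product as a bound P(S) ≤ T·Q(S) + K·T^{-α} + Δ for all T > 0 (`prod_renyi`), and
`exists_renyi_order` optimizes α at T = e^{Nε/2}. Here N = 1 for removal and N = 2 for replacement,
where the costs of the old and the new vector are added.

Accuracy: the pairs c cancel, so the error of an instance is a-b, with tail 2e^{-0.9εx}. Outside a
union bound of probability β all instances are accurate. Then a count above the threshold certifies
a nonempty class, so every summed class has 2^j < 2·Max², while every dropped class has at most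
twice the threshold many vectors. Both kinds of error are bounded by multiples of √(2^j), which sum
geometrically to O(Max) (`analyzer_error_le`).

Communication: the mean rp/(1-p) of NB(r,p) is summed over the instances, where the sum of √(2^j)
over all classes is O(√d). The encoding is a count of the possible messages. -/

/-- The law of the sum of two independent random elements of `M`. -/
def conv {M : Type*} [AddCommMonoid M] (P Q : PMF M) : PMF M :=
  P.bind fun s => Q.map fun t => s + t

/-- Laws on a commutative monoid form a commutative monoid under convolution. -/
instance convCommMonoid {M : Type*} [AddCommMonoid M] : CommMonoid (PMF M) where
  mul := conv
  one := PMF.pure 0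
  mul_assoc P Q R := by
    change conv (conv P Q) R = conv P (conv Q R)
    simp only [conv, PMF.bind_bind, PMF.bind_map, PMF.map_bind, PMF.map_comp, Function.comp_def,
      add_assoc]
  one_mul P := by
    change conv (PMF.pure 0) P = P
    simp only [conv, PMF.pure_bind, zero_add]
    exact PMF.map_id P
  mul_one P := by
    change conv P (PMF.pure 0) = P
    simp only [conv, PMF.pure_map, add_zero, PMF.bind_pure]
  mul_comm P Q := by
    change conv P Q = conv Q P
    simp only [conv, PMF.map, Function.comp_def]
    rw [PMF.bind_comm]
    simp only [add_comm]

section Conv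

variable {M N : Type*} [AddCommMonoid M] [AddCommMonoid N]

theorem conv_def (P Q : PMF M) : P * Q = P.bind fun s => Q.map fun t => s + t := rfl

theorem one_eq_pure : (1 : PMF M) = PMF.pure 0 := rfl

/-- Pushing laws forward along an additive homomorphism respects convolution. -/
def mapHom (f : M →+ N) : PMF M →* PMF N where
  toFun P := P.map f
  map_one' := by simp [one_eq_pure, PMF.pure_map]
  map_mul' P Q := by
    simp only [conv_def, PMF.map_bind, PMF.bind_map, PMF.map_comp, Function.comp_def, map_add]

@[simp] theorem mapHom_apply (f : M →+ N) (P : PMF M) : mapHom f P = P.map f := rfl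

theorem mapHom_mapHom {K : Type*} [AddCommMonoid K] (g : N →+ K) (f : M →+ N) (P : PMF M) :
    mapHom g (mapHom f P) = mapHom (g.comp f) P := by
  simp [PMF.map_comp, Function.comp_def]

theorem mapHom_zero (P : PMF M) : mapHom (0 : M →+ N) P = 1 := PMF.map_const P 0

theorem pure_mul_pure (a b : M) : (PMF.pure a * PMF.pure b : PMF M) = PMF.pure (a + b) := by
  simp [conv_def, PMF.pure_map]

theorem prod_pure {ι : Type*} (s : Finset ι) (f : ι → M) :
    ∏ i ∈ s, PMF.pure (f i) = PMF.pure (∑ i ∈ s, f i) := by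
  classical
  induction s using Finset.induction_on with
  | empty => rfl
  | insert a s ha ih => rw [Finset.prod_insert ha, Finset.sum_insert ha, ih, pure_mul_pure]

theorem toOuterMeasure_mul (P Q : PMF M) (S : Set M) :
    (P * Q).toOuterMeasure S = ∑' s, P s * Q.toOuterMeasure ((fun t => s + t) ⁻¹' S) := by
  simp [conv_def, PMF.toOuterMeasure_bind_apply, PMF.toOuterMeasure_map_apply]

theorem toOuterMeasure_mapHom (f : M →+ N) (P : PMF M) (S : Set N) :
    (mapHom f P).toOuterMeasure S = P.toOuterMeasure (f ⁻¹' S) := by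
  simp [PMF.toOuterMeasure_map_apply]

end Conv

/-! ### Views as convolution products, means and expected message counts. -/

theorem unionIndep_eq_prod {Z : Type} (L : List (PMF (Multiset Z))) : unionIndep L = L.prod := by
  induction L with
  | nil => rfl
  | cons P L ih => rw [List.prod_cons, ← ih]; rfl

theorem shuffledView_eq_prod {X Z : Type} {n : ℕ} (R : X → PMF (Multiset Z)) (D : Fin n → X) :
    shuffledView R D = ∏ i, R (D i) := by
  rw [shuffledView, unionIndep_eq_prod, List.prod_ofFn]

theorem toOuterMeasure_le_one {Ω : Type*} (P : PMF Ω) (S : Set Ω) : P.toOuterMeasure S ≤ 1 := by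
  rw [PMF.toOuterMeasure_apply, ← P.tsum_coe]
  exact ENNReal.tsum_le_tsum fun x => Set.indicator_le_self _ _ _

/-- The mean of `f` under the law `P`. -/
def mean {Ω : Type*} (P : PMF Ω) (f : Ω → ℝ≥0∞) : ℝ≥0∞ := ∑' s, P s * f s

theorem mean_bind {Ω Ω' : Type*} (P : PMF Ω) (κ : Ω → PMF Ω') (f : Ω' → ℝ≥0∞) :
    mean (P.bind κ) f = mean P fun s => mean (κ s) f := by
  simp only [mean, PMF.bind_apply, ← ENNReal.tsum_mul_left, ← ENNReal.tsum_mul_right]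
  rw [ENNReal.tsum_comm]
  simp only [mul_assoc]

theorem mean_pure {Ω : Type*} (a : Ω) (f : Ω → ℝ≥0∞) : mean (PMF.pure a) f = f a := by
  classical
  rw [mean, tsum_eq_single a]
  · simp
  · intro b hb; simp [PMF.pure_apply, hb]

theorem mean_map {Ω Ω' : Type*} (P : PMF Ω) (g : Ω → Ω') (f : Ω' → ℝ≥0∞) :
    mean (P.map g) f = mean P (f ∘ g) := by
  simp only [PMF.map, mean_bind, Function.comp_def, mean_pure]

theorem mean_add {Ω : Type*} (P : PMF Ω) (f g : Ω → ℝ≥0∞) :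
    mean P (fun s => f s + g s) = mean P f + mean P g := by
  simp only [mean, mul_add, ENNReal.tsum_add]

theorem mean_const {Ω : Type*} (P : PMF Ω) (c : ℝ≥0∞) : mean P (fun _ => c) = c := by
  simp [mean, ENNReal.tsum_mul_right, P.tsum_coe]

theorem expectedMessages_eq_mean {Z : Type} (P : PMF (Multiset Z)) :
    expectedMessages P = mean P fun s => (Multiset.card s : ℝ≥0∞) := rfl

theorem expectedMessages_mul {Z : Type} (P Q : PMF (Multiset Z)) :
    expectedMessages (P * Q) = expectedMessages P + expectedMessages Q := by
  simp only [expectedMessages_eq_mean, conv_def, mean_bind, mean_map, Function.comp_def,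
    Multiset.card_add, Nat.cast_add, mean_add, mean_const]

theorem expectedMessages_prod {Z ι : Type} (s : Finset ι) (P : ι → PMF (Multiset Z)) :
    expectedMessages (∏ i ∈ s, P i) = ∑ i ∈ s, expectedMessages (P i) := by
  classical
  induction s using Finset.induction_on with
  | empty => simp [one_eq_pure, expectedMessages_eq_mean, mean_pure]
  | insert a s ha ih => rw [Finset.prod_insert ha, Finset.sum_insert ha, expectedMessages_mul, ih]

/-! ### Approximate indistinguishability -/

/-- `P` and `Q` agree up to the factor `exp a` in both directions, after mass `η` is removed from
each of them. -/
def Indist {Ω : Type*} (a : ℝ) (η : ℝ≥0∞) (P Q : PMF Ω) : Prop :=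
  ∃ P' Q' : Ω → ℝ≥0∞, (∀ x, P' x ≤ P x) ∧ (∀ x, Q' x ≤ Q x) ∧ ∑' x, P' x = ∑' x, Q' x ∧
    1 ≤ ∑' x, P' x + η ∧ (∀ x, P' x ≤ ENNReal.ofReal (Real.exp a) * Q' x) ∧
    ∀ x, Q' x ≤ ENNReal.ofReal (Real.exp a) * P' x

theorem Indist.symm {Ω : Type*} {a : ℝ} {η : ℝ≥0∞} {P Q : PMF Ω} (h : Indist a η P Q) :
    Indist a η Q P := by
  obtain ⟨P', Q', hP, hQ, he, hm, h1, h2⟩ := h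
  exact ⟨Q', P', hQ, hP, he.symm, he ▸ hm, h2, h1⟩

theorem Indist.refl {Ω : Type*} (P : PMF Ω) : Indist 0 0 P P :=
  ⟨P, P, fun _ => le_rfl, fun _ => le_rfl, rfl, by simp [P.tsum_coe], by simp, by simp⟩

theorem Indist.map {Ω Ω' : Type*} {a : ℝ} {η : ℝ≥0∞} {P Q : PMF Ω} (h : Indist a η P Q)
    (f : Ω → Ω') : Indist a η (P.map f) (Q.map f) := by
  classical
  obtain ⟨P', Q', hP, hQ, he, hm, h1, h2⟩ := h
  have hsum : ∀ F : Ω → ℝ≥0∞, ∑' y, ∑' x, (if y = f x then F x else 0) = ∑' x, F x := by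
    intro F
    rw [ENNReal.tsum_comm]
    exact tsum_congr fun x => tsum_ite_eq _ _
  have hmul : ∀ F G : Ω → ℝ≥0∞, (∀ x, F x ≤ ENNReal.ofReal (Real.exp a) * G x) → ∀ y,
      ∑' x, (if y = f x then F x else 0) ≤
        ENNReal.ofReal (Real.exp a) * ∑' x, if y = f x then G x else 0 := by
    intro F G hFG y
    rw [← ENNReal.tsum_mul_left]
    refine ENNReal.tsum_le_tsum fun x => ?_
    split_ifs
    · exact hFG x
    · simp
  have hle : ∀ (F : Ω → ℝ≥0∞) (R : PMF Ω), (∀ x, F x ≤ R x) → ∀ y,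
      ∑' x, (if y = f x then F x else 0) ≤ R.map f y := by
    intro F R hFR y
    rw [PMF.map_apply]
    refine ENNReal.tsum_le_tsum fun x => ?_
    split_ifs with h
    · exact hFR x
    · simp
  refine ⟨fun y => ∑' x, if y = f x then P' x else 0, fun y => ∑' x, if y = f x then Q' x else 0,
    hle P' P hP, hle Q' Q hQ, ?_, ?_, hmul _ _ h1, hmul _ _ h2⟩
  · rw [hsum, hsum, he]
  · rw [hsum]; exact hm

theorem Indist.mul_left {M : Type*} [AddCommMonoid M] {a : ℝ} {η : ℝ≥0∞} {P Q : PMF M}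
    (h : Indist a η P Q) (m : M) : Indist a η (PMF.pure m * P) (PMF.pure m * Q) := by
  simp only [conv_def, PMF.pure_bind]
  exact h.map _

/-- One-sided domination together with domination up to mass `η` in the other direction gives
indistinguishability. -/
theorem indist_of_le {Ω : Type*} {a : ℝ} (ha : 0 ≤ a) {η : ℝ≥0∞} {P Q : PMF Ω}
    (hPQ : ∀ x, P x ≤ ENNReal.ofReal (Real.exp a) * Q x) (T : Ω → ℝ≥0∞)
    (hTQ : ∀ x, T x ≤ Q x) (hTP : ∀ x, T x ≤ ENNReal.ofReal (Real.exp a) * P x)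
    (hT : 1 ≤ ∑' x, T x + η) : Indist a η P Q := by
  set E := ENNReal.ofReal (Real.exp a) with hE
  have hE1 : 1 ≤ E := by
    rw [hE, ENNReal.one_le_ofReal]; exact Real.one_le_exp ha
  -- Q' is the largest part of Q dominated by E·P, so it lies above T and keeps mass at least 1-η. P
  -- has to be thinned to the same mass without dropping below U = min(P, Q'). Any P' between U and
  -- P satisfies both ratio bounds: P' ≤ P ≤ E·Q' and Q' ≤ E·U ≤ E·P'.
  set Q' : Ω → ℝ≥0∞ := fun x => min (Q x) (E * P x) with hQ'
  set U : Ω → ℝ≥0∞ := fun x => min (P x) (Q' x) with hU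
  have hQ'Q : ∀ x, Q' x ≤ Q x := fun x => min_le_left _ _
  have hUP : ∀ x, U x ≤ P x := fun x => min_le_left _ _
  have hmQ : ∑' x, Q' x ≤ 1 := Q.tsum_coe ▸ ENNReal.tsum_le_tsum hQ'Q
  have hmU : ∑' x, U x ≤ ∑' x, Q' x := ENNReal.tsum_le_tsum fun x => min_le_right _ _
  -- a convex combination of `U` and `P` has the same mass as `Q'`
  obtain ⟨θ, θ', hθ, hmass⟩ : ∃ θ θ' : ℝ≥0∞, θ + θ' = 1 ∧
      θ * 1 + θ' * ∑' x, U x = ∑' x, Q' x := by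
    generalize ∑' x, U x = u at hmU ⊢
    generalize ∑' x, Q' x = q at hmQ hmU ⊢
    have hq : q ≠ ⊤ := ne_top_of_le_ne_top ENNReal.one_ne_top hmQ
    have hu : u ≠ ⊤ := ne_top_of_le_ne_top hq hmU
    rcases eq_or_ne u 1 with h1 | h1
    · exact ⟨1, 0, by simp, by simp; exact le_antisymm (h1 ▸ hmU) hmQ⟩
    · lift u to NNReal using hu
      lift q to NNReal using hq
      have hu1 : (u : ℝ) < 1 := by
        have : u ≠ 1 := by exact_mod_cast h1
        have h2 : u ≤ 1 := by exact_mod_cast hmU.trans hmQ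
        exact_mod_cast lt_of_le_of_ne h2 this
      have huq : (u : ℝ) ≤ q := by exact_mod_cast hmU
      have hq1 : (q : ℝ) ≤ 1 := by exact_mod_cast hmQ
      have hpos : 0 < 1 - (u : ℝ) := by linarith
      obtain ⟨θ, hθ⟩ : ∃ θ : NNReal, (θ : ℝ) = (q - u) / (1 - u) :=
        ⟨Real.toNNReal _, Real.coe_toNNReal _ (div_nonneg (by linarith) hpos.le)⟩
      obtain ⟨θ', hθ'⟩ : ∃ θ : NNReal, (θ : ℝ) = (1 - q) / (1 - u) :=
        ⟨Real.toNNReal _, Real.coe_toNNReal _ (div_nonneg (by linarith) hpos.le)⟩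
      refine ⟨θ, θ', ?_, ?_⟩
      · norm_cast
        apply NNReal.eq
        push_cast
        rw [hθ, hθ']
        field_simp; ring
      · norm_cast
        apply NNReal.eq
        push_cast
        rw [hθ, hθ']
        field_simp; ring
  set P' : Ω → ℝ≥0∞ := fun x => θ * P x + θ' * U x with hP'
  have hUP' : ∀ x, U x ≤ P' x := fun x => by
    calc U x = θ * U x + θ' * U x := by rw [← add_mul, hθ, one_mul]
      _ ≤ θ * P x + θ' * U x := by gcongr; exact hUP x
  have hP'P : ∀ x, P' x ≤ P x := fun x => by
    calc θ * P x + θ' * U x ≤ θ * P x + θ' * P x := by gcongr; exact hUP x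
      _ = P x := by rw [← add_mul, hθ, one_mul]
  refine ⟨P', Q', hP'P, hQ'Q, ?_, ?_, fun x => ?_, fun x => ?_⟩
  · rw [hP', ENNReal.tsum_add, ENNReal.tsum_mul_left, ENNReal.tsum_mul_left, P.tsum_coe, hmass]
  · have : ∑' x, P' x = ∑' x, Q' x := by
      rw [hP', ENNReal.tsum_add, ENNReal.tsum_mul_left, ENNReal.tsum_mul_left, P.tsum_coe, hmass]
    rw [this]
    exact hT.trans (by gcongr with x; exact le_min (hTQ x) (hTP x))
  · refine (hP'P x).trans ?_
    rw [hQ']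
    simp only [mul_min]
    refine le_min (hPQ x) ?_
    calc P x = 1 * (1 * P x) := by simp
      _ ≤ E * (E * P x) := by gcongr
  · refine le_trans ?_ (mul_le_mul_right (hUP' x) E)
    rw [hU]
    simp only [mul_min]
    refine le_min (min_le_right _ _) ?_
    calc Q' x = 1 * Q' x := by simp
      _ ≤ E * Q' x := by gcongr

theorem Indist.tsum_sub_le {Ω : Type*} {η : ℝ≥0∞} {P : PMF Ω} {P' : Ω → ℝ≥0∞}
    (hP : ∀ x, P' x ≤ P x) (hm : 1 ≤ ∑' x, P' x + η) : ∑' x, (P x - P' x) ≤ η := by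
  have h1 : ∑' x, P' x ≠ ⊤ :=
    ne_top_of_le_ne_top ENNReal.one_ne_top (P.tsum_coe ▸ ENNReal.tsum_le_tsum hP)
  refine (ENNReal.add_le_add_iff_left h1).1 ?_
  rw [← ENNReal.tsum_add]
  simpa only [add_tsub_cancel_of_le (hP _), P.tsum_coe] using hm

/-- Removing mass `η` from the first factor of a convolution changes probabilities by at most
`η`. -/
theorem toOuterMeasure_mul_le {M : Type*} [AddCommMonoid M] {η : ℝ≥0∞} {P R : PMF M}
    {P' : M → ℝ≥0∞} (hP : ∀ x, P' x ≤ P x) (hm : 1 ≤ ∑' x, P' x + η) (S : Set M) :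
    (P * R).toOuterMeasure S ≤
      ∑' s, P' s * R.toOuterMeasure ((fun t => s + t) ⁻¹' S) + η := by
  rw [toOuterMeasure_mul]
  calc ∑' s, P s * R.toOuterMeasure ((fun t => s + t) ⁻¹' S)
      ≤ ∑' s, (P' s * R.toOuterMeasure ((fun t => s + t) ⁻¹' S) + (P s - P' s)) := by
        refine ENNReal.tsum_le_tsum fun s => ?_
        conv_lhs => rw [← add_tsub_cancel_of_le (hP s), add_mul]
        gcongr
        exact mul_le_of_le_one_right' (toOuterMeasure_le_one _ _)
    _ ≤ _ := by
        rw [ENNReal.tsum_add]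
        gcongr
        exact Indist.tsum_sub_le hP hm

/-- Composition of an indistinguishable pair with an arbitrary differentially private pair. -/
theorem Indist.mul_dp {M : Type*} [AddCommMonoid M] {a : ℝ} {η E Δ : ℝ≥0∞} {P Q P₀ Q₀ : PMF M}
    (h : Indist a η P Q)
    (h₀ : ∀ S, P₀.toOuterMeasure S ≤ E * Q₀.toOuterMeasure S + Δ) (S : Set M) :
    (P * P₀).toOuterMeasure S ≤
      ENNReal.ofReal (Real.exp a) * E * (Q * Q₀).toOuterMeasure S + (η + Δ) := by
  obtain ⟨P', Q', hP, hQ, he, hm, h1, h2⟩ := h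
  refine (toOuterMeasure_mul_le hP hm S).trans ?_
  rw [add_comm η, ← add_assoc]
  gcongr
  calc ∑' s, P' s * P₀.toOuterMeasure ((fun t => s + t) ⁻¹' S)
      ≤ ∑' s, (ENNReal.ofReal (Real.exp a) * E *
          (Q s * Q₀.toOuterMeasure ((fun t => s + t) ⁻¹' S)) + P s * Δ) := by
        refine ENNReal.tsum_le_tsum fun s => ?_
        calc _ ≤ P' s * (E * Q₀.toOuterMeasure ((fun t => s + t) ⁻¹' S) + Δ) := by
              gcongr; exact h₀ _
          _ ≤ (ENNReal.ofReal (Real.exp a) * Q s) *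
                (E * Q₀.toOuterMeasure ((fun t => s + t) ⁻¹' S)) + P s * Δ := by
              rw [mul_add]
              gcongr
              · exact (h1 s).trans (by gcongr; exact hQ s)
              · exact hP s
          _ = _ := by ring
    _ = _ := by
        rw [ENNReal.tsum_add, ENNReal.tsum_mul_left, ENNReal.tsum_mul_right, P.tsum_coe, one_mul,
          toOuterMeasure_mul]

theorem prod_mul_dp {M ι : Type*} [AddCommMonoid M] (s : Finset ι) {a : ι → ℝ} {η : ι → ℝ≥0∞}
    {E Δ : ℝ≥0∞} {P Q : ι → PMF M} {P₀ Q₀ : PMF M} (h : ∀ i ∈ s, Indist (a i) (η i) (P i) (Q i))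
    (h₀ : ∀ S, P₀.toOuterMeasure S ≤ E * Q₀.toOuterMeasure S + Δ) (S : Set M) :
    ((∏ i ∈ s, P i) * P₀).toOuterMeasure S ≤
      ENNReal.ofReal (Real.exp (∑ i ∈ s, a i)) * E * ((∏ i ∈ s, Q i) * Q₀).toOuterMeasure S +
        (∑ i ∈ s, η i + Δ) := by
  classical
  induction s using Finset.induction_on generalizing S with
  | empty => simpa using h₀ S
  | insert i s hi ih =>
    have := (h i (Finset.mem_insert_self _ _)).mul_dp
      (ih fun j hj => h j (Finset.mem_insert_of_mem hj)) S
    simp only [Finset.prod_insert hi, Finset.sum_insert hi, mul_assoc, add_assoc, Real.exp_add,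
      ENNReal.ofReal_mul (Real.exp_pos (a i)).le] at this ⊢
    exact this

/-! ### Rényi moments -/

/-- The derivative of y cosh y - sinh y is y sinh y, which is nonnegative for y ≥ 0. -/
theorem sinh_le_mul_cosh {x : ℝ} (hx : 0 ≤ x) : Real.sinh x ≤ x * Real.cosh x := by
  have hd : ∀ y : ℝ, HasDerivAt (fun y => y * Real.cosh y - Real.sinh y) (y * Real.sinh y) y := by
    intro y
    exact (((hasDerivAt_id' y).fun_mul (Real.hasDerivAt_cosh y)).fun_sub
      (Real.hasDerivAt_sinh y)).congr_deriv (by ring)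
  have hm : MonotoneOn (fun y => y * Real.cosh y - Real.sinh y) (Set.Ici 0) := by
    refine monotoneOn_of_deriv_nonneg (convex_Ici 0)
      (fun y _ => (hd y).continuousAt.continuousWithinAt)
      (fun y _ => (hd y).differentiableAt.differentiableWithinAt) fun y hy => ?_
    rw [(hd y).deriv]
    have hy0 : 0 ≤ y := by simpa using interior_subset hy
    exact mul_nonneg hy0 (Real.sinh_nonneg_iff.2 hy0)
  have := hm (Set.mem_Ici.2 le_rfl) (Set.mem_Ici.2 hx) hx
  simp at this
  linarith

/-- The function cosh z · e^{-z²/2} is antitone on [0, ∞), because its derivative has the sign of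
sinh z - z cosh z. -/
theorem cosh_div_cosh_le {x y : ℝ} (hx : 0 ≤ x) (hxy : x ≤ y) :
    Real.cosh y / Real.cosh x ≤ Real.exp ((y ^ 2 - x ^ 2) / 2) := by
  have hd : ∀ z : ℝ, HasDerivAt (fun z => Real.cosh z * Real.exp (-(z ^ 2 / 2)))
      ((Real.sinh z - z * Real.cosh z) * Real.exp (-(z ^ 2 / 2))) z := by
    intro z
    have h1 : HasDerivAt (fun z : ℝ => -(z ^ 2 / 2)) (-z) z :=
      (((hasDerivAt_id' z).fun_pow 2).div_const 2).fun_neg.congr_deriv (by norm_num)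
    exact ((Real.hasDerivAt_cosh z).fun_mul h1.exp).congr_deriv (by ring)
  have hm : AntitoneOn (fun z => Real.cosh z * Real.exp (-(z ^ 2 / 2))) (Set.Ici 0) := by
    refine antitoneOn_of_deriv_nonpos (convex_Ici 0)
      (fun y _ => (hd y).continuousAt.continuousWithinAt)
      (fun y _ => (hd y).differentiableAt.differentiableWithinAt) fun y hy => ?_
    rw [(hd y).deriv]
    have hy0 : 0 ≤ y := by simpa using interior_subset hy
    exact mul_nonpos_of_nonpos_of_nonneg (by linarith [sinh_le_mul_cosh hy0]) (Real.exp_pos _).le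
  have h := hm (Set.mem_Ici.2 hx) (Set.mem_Ici.2 (hx.trans hxy)) hxy
  simp only at h
  rw [div_le_iff₀ (Real.cosh_pos x)]
  calc Real.cosh y = Real.cosh y * Real.exp (-(y ^ 2 / 2)) * Real.exp (y ^ 2 / 2) := by
        rw [mul_assoc, ← Real.exp_add]; simp
    _ ≤ Real.cosh x * Real.exp (-(x ^ 2 / 2)) * Real.exp (y ^ 2 / 2) := by gcongr
    _ = _ := by
        rw [mul_assoc, ← Real.exp_add, mul_comm]; congr 2; ring

/-- The Rényi moment of randomized response. -/
theorem randomizedResponse_moment_le {a α : ℝ} (ha : 0 < a) (hα : 0 < α) :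
    ((Real.exp a - 1) * Real.exp (-a * (1 + α)) + (1 - Real.exp (-a)) * Real.exp (a * (1 + α))) /
      (Real.exp a - Real.exp (-a)) ≤ Real.exp (α * (α + 1) / 2 * a ^ 2) := by
  -- The moment of randomized response is exactly cosh((α+1/2)a) / cosh(a/2). The rest of the proof
  -- is this identity, written in y = e^{a/2}.
  have h := cosh_div_cosh_le (x := a / 2) (y := (α + 1 / 2) * a) (by linarith) (by nlinarith)
  have e : ((((α + 1 / 2) * a) ^ 2 - (a / 2) ^ 2) / 2) = α * (α + 1) / 2 * a ^ 2 := by ring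
  rw [e] at h
  refine le_trans (le_of_eq ?_) h
  rw [Real.cosh_eq, Real.cosh_eq]
  have hy : 1 < Real.exp (a / 2) := Real.one_lt_exp_iff.2 (by linarith)
  have e1 : Real.exp a = Real.exp (a / 2) * Real.exp (a / 2) := by
    rw [← Real.exp_add]; congr 1; ring
  have e2 : Real.exp (-a) = (Real.exp (a / 2))⁻¹ * (Real.exp (a / 2))⁻¹ := by
    rw [← Real.exp_neg, ← Real.exp_add]; congr 1; ring
  have e3 : Real.exp (a * (1 + α)) = Real.exp (a / 2) * Real.exp ((α + 1 / 2) * a) := by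
    rw [← Real.exp_add]; congr 1; ring
  have e4 : Real.exp (-a * (1 + α)) = (Real.exp (a / 2))⁻¹ * Real.exp (-((α + 1 / 2) * a)) := by
    rw [← Real.exp_neg, ← Real.exp_add]; congr 1; ring
  rw [e3, e4, e1, e2, Real.exp_neg (a / 2)]
  generalize Real.exp (a / 2) = y at hy
  generalize Real.exp ((α + 1 / 2) * a) = u
  generalize Real.exp (-((α + 1 / 2) * a)) = v
  have hy0 : 0 < y := by linarith
  have h1 : y * y - y⁻¹ * y⁻¹ ≠ 0 := by
    have : y⁻¹ < 1 := inv_lt_one_of_one_lt₀ hy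
    have h2 : 0 < y⁻¹ := by positivity
    nlinarith
  have h2 : (y + y⁻¹) / 2 ≠ 0 := by positivity
  rw [div_eq_div_iff h1 h2]
  field_simp
  ring

/-- By convexity, r^β lies below its chord over [e^{-a}, e^a]. This makes randomized response, whose
ratios are the two endpoints, the worst case. -/
theorem rpow_le_chord {a β r : ℝ} (ha : 0 < a) (hβ : 1 ≤ β) (h1 : Real.exp (-a) ≤ r)
    (h2 : r ≤ Real.exp a) :
    r ^ β ≤ ((Real.exp a - r) * Real.exp (-a * β) + (r - Real.exp (-a)) * Real.exp (a * β)) /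
      (Real.exp a - Real.exp (-a)) := by
  have hpos : 0 < Real.exp a - Real.exp (-a) := by
    have : Real.exp (-a) < Real.exp a := Real.exp_lt_exp.2 (by linarith)
    linarith
  have hl : 0 ≤ (Real.exp a - r) / (Real.exp a - Real.exp (-a)) :=
    div_nonneg (by linarith) hpos.le
  have hr : 0 ≤ (r - Real.exp (-a)) / (Real.exp a - Real.exp (-a)) :=
    div_nonneg (by linarith) hpos.le
  have := (convexOn_rpow hβ).2 (Set.mem_Ici.2 (Real.exp_pos (-a)).le)
    (Set.mem_Ici.2 (Real.exp_pos a).le) hl hr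
    (by rw [← add_div, div_eq_one_iff_eq hpos.ne']; ring)
  simp only [smul_eq_mul, ← Real.exp_mul] at this
  refine le_trans (le_of_eq ?_) (this.trans (le_of_eq ?_))
  · congr 1
    rw [div_mul_eq_mul_div, div_mul_eq_mul_div, ← add_div, eq_div_iff hpos.ne']; ring
  · rw [div_mul_eq_mul_div, div_mul_eq_mul_div, ← add_div]

/-- The chord bound for the ratio P/Q, multiplied by Q, is a linear combination A·Q + B·P. Only the
total masses of P and Q then matter. Equality of the masses is essential since A may be negative:
with a common mass at most 1, the sum of A·Q + B·P is controlled by A + B, the moment of randomized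
response. -/
theorem tsum_renyi_le {Ω : Type*} {a α : ℝ} (ha : 0 ≤ a) (hα : 0 < α) {P Q : Ω → ℝ≥0∞}
    (hm : ∑' x, P x = ∑' x, Q x) (hm1 : ∑' x, P x ≤ 1)
    (h1 : ∀ x, P x ≤ ENNReal.ofReal (Real.exp a) * Q x)
    (h2 : ∀ x, Q x ≤ ENNReal.ofReal (Real.exp a) * P x) :
    ∑' x, ENNReal.ofReal ((P x).toReal * ((P x).toReal / (Q x).toReal) ^ α) ≤
      ENNReal.ofReal (Real.exp (α * (α + 1) / 2 * a ^ 2)) := by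
  have hPtop : ∑' x, P x ≠ ⊤ := ne_top_of_le_ne_top ENNReal.one_ne_top hm1
  have hQtop : ∑' x, Q x ≠ ⊤ := hm ▸ hPtop
  have hP : ∀ x, P x ≠ ⊤ := ENNReal.ne_top_of_tsum_ne_top hPtop
  have hQ : ∀ x, Q x ≠ ⊤ := ENNReal.ne_top_of_tsum_ne_top hQtop
  set p : Ω → ℝ := fun x => (P x).toReal with hp
  set q : Ω → ℝ := fun x => (Q x).toReal with hq
  have hp0 : ∀ x, 0 ≤ p x := fun x => ENNReal.toReal_nonneg
  have hq0 : ∀ x, 0 ≤ q x := fun x => ENNReal.toReal_nonneg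
  have hle : ∀ {F G : ℝ≥0∞}, G ≠ ⊤ → F ≤ ENNReal.ofReal (Real.exp a) * G →
      F.toReal ≤ Real.exp a * G.toReal := by
    intro F G hG h
    have := ENNReal.toReal_mono (ENNReal.mul_ne_top ENNReal.ofReal_ne_top hG) h
    rwa [ENNReal.toReal_mul, ENNReal.toReal_ofReal (Real.exp_pos a).le] at this
  have hpq : ∀ x, p x ≤ Real.exp a * q x := fun x => hle (hQ x) (h1 x)
  have hqp : ∀ x, q x ≤ Real.exp a * p x := fun x => hle (hP x) (h2 x)
  have hps : Summable p := ENNReal.summable_toReal hPtop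
  have hqs : Summable q := ENNReal.summable_toReal hQtop
  have hpm : ∑' x, p x = (∑' x, P x).toReal := (ENNReal.tsum_toReal_eq hP).symm
  have hqm : ∑' x, q x = (∑' x, P x).toReal := by rw [hm]; exact (ENNReal.tsum_toReal_eq hQ).symm
  have hm1' : (∑' x, P x).toReal ≤ 1 := by
    have := ENNReal.toReal_mono ENNReal.one_ne_top hm1
    simpa using this
  -- the pointwise bound by a linear combination of the two densities
  obtain ⟨A, B, hAB, hlin⟩ : ∃ A B : ℝ, A + B ≤ Real.exp (α * (α + 1) / 2 * a ^ 2) ∧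
      ∀ x, p x * (p x / q x) ^ α ≤ A * q x + B * p x := by
    -- For a = 0 the interval of the chord degenerates to a point, and P = Q.
    rcases ha.eq_or_lt with rfl | ha
    · refine ⟨0, 1, by simp, fun x => ?_⟩
      have : p x = q x := le_antisymm (by simpa using hpq x) (by simpa using hqp x)
      rw [this]
      rcases eq_or_ne (q x) 0 with h | h
      · simp [h]
      · simp [div_self h]
    · have hpos : 0 < Real.exp a - Real.exp (-a) := by
        have : Real.exp (-a) < Real.exp a := Real.exp_lt_exp.2 (by linarith)
        linarith
      refine ⟨(Real.exp a * Real.exp (-a * (1 + α)) - Real.exp (-a) * Real.exp (a * (1 + α))) /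
          (Real.exp a - Real.exp (-a)), (Real.exp (a * (1 + α)) - Real.exp (-a * (1 + α))) /
          (Real.exp a - Real.exp (-a)), ?_, fun x => ?_⟩
      · refine le_trans (le_of_eq ?_) (randomizedResponse_moment_le ha hα)
        rw [← add_div]; congr 1; ring
      · rcases (hq0 x).eq_or_lt with h | h
        · have : p x = 0 := le_antisymm (by simpa [← h] using hpq x) (hp0 x)
          simp [this, ← h]
        · have hppos : 0 < p x := by
            by_contra hc
            have : p x = 0 := le_antisymm (not_lt.1 hc) (hp0 x)
            have := hqp x
            simp_all
            linarith
          have hch := rpow_le_chord (r := p x / q x) (β := 1 + α) ha (by linarith)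
            (by rw [Real.exp_neg, le_div_iff₀ h, inv_mul_le_iff₀ (Real.exp_pos a)]; exact hqp x)
            (by rw [div_le_iff₀ h]; exact hpq x)
          rw [Real.rpow_add (by positivity), Real.rpow_one] at hch
          calc p x * (p x / q x) ^ α = q x * (p x / q x * (p x / q x) ^ α) := by field_simp
            _ ≤ _ := mul_le_mul_of_nonneg_left hch h.le
            _ = _ := by field_simp; ring
  have hF0 : ∀ x, 0 ≤ p x * (p x / q x) ^ α := fun x =>
    mul_nonneg (hp0 x) (Real.rpow_nonneg (div_nonneg (hp0 x) (hq0 x)) _)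
  have hsum : Summable fun x => A * q x + B * p x := (hqs.mul_left A).add (hps.mul_left B)
  calc ∑' x, ENNReal.ofReal (p x * (p x / q x) ^ α)
      ≤ ∑' x, ENNReal.ofReal (A * q x + B * p x) :=
        ENNReal.tsum_le_tsum fun x => ENNReal.ofReal_le_ofReal (hlin x)
    _ = ENNReal.ofReal (∑' x, (A * q x + B * p x)) :=
        (ENNReal.ofReal_tsum_of_nonneg (fun x => (hF0 x).trans (hlin x)) hsum).symm
    _ ≤ _ := by
        refine ENNReal.ofReal_le_ofReal ?_
        rw [(hqs.mul_left A).tsum_add (hps.mul_left B), tsum_mul_left, tsum_mul_left, hpm, hqm,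
          ← add_mul]
        rcases le_total 0 (A + B) with h | h
        · exact (mul_le_of_le_one_right h hm1').trans hAB
        · exact (mul_nonpos_of_nonpos_of_nonneg h ENNReal.toReal_nonneg).trans (Real.exp_pos _).le

/-- Composition step for bounds on privacy loss distributions. -/
theorem Indist.mul_renyi {M : Type*} [AddCommMonoid M] {a α K : ℝ} (ha : 0 ≤ a) (hα : 0 < α)
    (hK : 0 ≤ K) {η Δ : ℝ≥0∞} {P Q P₀ Q₀ : PMF M} (h : Indist a η P Q)
    (h₀ : ∀ S, ∀ T : ℝ, 0 < T → P₀.toOuterMeasure S ≤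
      ENNReal.ofReal T * Q₀.toOuterMeasure S + ENNReal.ofReal (K * T ^ (-α)) + Δ)
    (S : Set M) (T : ℝ) (hT : 0 < T) :
    (P * P₀).toOuterMeasure S ≤ ENNReal.ofReal T * (Q * Q₀).toOuterMeasure S +
      ENNReal.ofReal (Real.exp (α * (α + 1) / 2 * a ^ 2) * K * T ^ (-α)) + (η + Δ) := by
  obtain ⟨P', Q', hP, hQ, he, hm, h1, h2⟩ := h
  have hPm : ∑' x, P' x ≤ 1 := P.tsum_coe ▸ ENNReal.tsum_le_tsum hP
  have hmom := tsum_renyi_le ha hα he hPm h1 h2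
  refine (toOuterMeasure_mul_le hP hm S).trans ?_
  rw [add_comm η, ← add_assoc]
  gcongr
  have hfin : ∀ x, P' x ≠ ⊤ := fun x => ne_top_of_le_ne_top (P.apply_ne_top x) (hP x)
  have hfinQ : ∀ x, Q' x ≠ ⊤ := fun x => ne_top_of_le_ne_top (Q.apply_ne_top x) (hQ x)
  calc ∑' s, P' s * P₀.toOuterMeasure ((fun t => s + t) ⁻¹' S)
      ≤ ∑' s, (ENNReal.ofReal T * (Q s * Q₀.toOuterMeasure ((fun t => s + t) ⁻¹' S)) +
          ENNReal.ofReal (K * T ^ (-α)) *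
            ENNReal.ofReal ((P' s).toReal * ((P' s).toReal / (Q' s).toReal) ^ α) + P s * Δ) := by
        refine ENNReal.tsum_le_tsum fun s => ?_
        rcases eq_or_ne (P' s) 0 with hz | hz
        · simp [hz]
        have hqz : Q' s ≠ 0 := by
          intro hq; apply hz; simpa [hq] using h1 s
        have hp : 0 < (P' s).toReal := ENNReal.toReal_pos hz (hfin s)
        have hq : 0 < (Q' s).toReal := ENNReal.toReal_pos hqz (hfinQ s)
        -- Given the value s of the first factor, the remaining privacy loss is tested at the
        -- threshold T·Q'(s)/P'(s). The main term then becomes T·Q'(s), and the power of the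
        -- threshold produces (P'/Q')^α, which averages to the Rényi moment.
        have hT' : 0 < T * (Q' s).toReal / (P' s).toReal := by positivity
        have hPs : P' s = ENNReal.ofReal (P' s).toReal := (ENNReal.ofReal_toReal (hfin s)).symm
        have hQs : Q' s = ENNReal.ofReal (Q' s).toReal := (ENNReal.ofReal_toReal (hfinQ s)).symm
        refine (mul_le_mul_right (h₀ ((fun t => s + t) ⁻¹' S) _ hT') (P' s)).trans ?_
        rw [mul_add, mul_add]
        refine add_le_add (add_le_add ?_ ?_) ?_
        · rw [← mul_assoc, ← mul_assoc]
          refine mul_le_mul_left ?_ _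
          calc P' s * ENNReal.ofReal (T * (Q' s).toReal / (P' s).toReal)
              = ENNReal.ofReal T * Q' s := by
                rw [hPs, hQs, ← ENNReal.ofReal_mul hp.le, ← ENNReal.ofReal_mul hT.le,
                  ENNReal.toReal_ofReal hp.le, ENNReal.toReal_ofReal hq.le]
                congr 1; field_simp
            _ ≤ _ := by gcongr; exact hQ s
        · apply le_of_eq
          conv_lhs => enter [1]; rw [hPs]
          rw [← ENNReal.ofReal_mul hp.le, ← ENNReal.ofReal_mul (by positivity)]
          congr 1
          rw [mul_div_assoc, Real.mul_rpow hT.le (by positivity),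
            Real.rpow_neg (x := (Q' s).toReal / (P' s).toReal) (by positivity),
            ← Real.inv_rpow (by positivity), inv_div]
          ring
        · gcongr; exact hP s
    _ = ENNReal.ofReal T * (Q * Q₀).toOuterMeasure S + ENNReal.ofReal (K * T ^ (-α)) *
          ∑' s, ENNReal.ofReal ((P' s).toReal * ((P' s).toReal / (Q' s).toReal) ^ α) + Δ := by
        rw [ENNReal.tsum_add, ENNReal.tsum_add, ENNReal.tsum_mul_left, ENNReal.tsum_mul_left,
          ENNReal.tsum_mul_right, P.tsum_coe, one_mul, toOuterMeasure_mul]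
    _ ≤ _ := by
        gcongr
        calc _ ≤ ENNReal.ofReal (K * T ^ (-α)) *
              ENNReal.ofReal (Real.exp (α * (α + 1) / 2 * a ^ 2)) := by gcongr
          _ = _ := by
            rw [← ENNReal.ofReal_mul (by positivity)]; congr 1; ring

/-- Advanced composition, in the form of a bound for all thresholds of the privacy loss. -/
theorem prod_renyi {M ι : Type*} [AddCommMonoid M] (s : Finset ι) {a : ι → ℝ} {η : ι → ℝ≥0∞}
    {α c : ℝ} (hα : 0 < α) (hc : ∀ T : ℝ, 0 < T → 1 ≤ T + c * T ^ (-α)) (hc0 : 0 ≤ c)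
    {P Q : ι → PMF M} (ha : ∀ i ∈ s, 0 ≤ a i) (h : ∀ i ∈ s, Indist (a i) (η i) (P i) (Q i))
    (S : Set M) (T : ℝ) (hT : 0 < T) :
    (∏ i ∈ s, P i).toOuterMeasure S ≤ ENNReal.ofReal T * (∏ i ∈ s, Q i).toOuterMeasure S +
      ENNReal.ofReal (Real.exp (α * (α + 1) / 2 * ∑ i ∈ s, a i ^ 2) * c * T ^ (-α)) +
        ∑ i ∈ s, η i := by
  classical
  induction s using Finset.induction_on generalizing S T with
  | empty =>
    -- Both empty products are the point mass at 0, so for S containing 0 the claim is 1 ≤ T +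
    -- c·T^{-α}. A constant c below 1 is what improves on the plain Markov tail bound.
    simp only [Finset.prod_empty, Finset.sum_empty, mul_zero, Real.exp_zero, one_mul, add_zero]
    rw [one_eq_pure, PMF.toOuterMeasure_pure_apply]
    split_ifs
    · rw [mul_one, ← ENNReal.ofReal_add hT.le (mul_nonneg hc0 (Real.rpow_nonneg hT.le _)),
        ENNReal.one_le_ofReal]
      exact hc T hT
    · simp
  | insert i s hi ih =>
    have := (h i (Finset.mem_insert_self _ _)).mul_renyi (ha i (Finset.mem_insert_self _ _)) hα
      (mul_nonneg (Real.exp_pos _).le hc0)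
      (ih (fun j hj => ha j (Finset.mem_insert_of_mem hj))
        fun j hj => h j (Finset.mem_insert_of_mem hj)) S T hT
    rw [Finset.prod_insert hi, Finset.prod_insert hi, Finset.sum_insert hi, Finset.sum_insert hi,
      mul_add, Real.exp_add]
    simpa only [mul_assoc] using this

/-! ### Properties of the negative binomial distribution -/

/-- Rising factorials become binomial coefficients with upper argument -r, a form in which
Vandermonde's identity adds the upper arguments. -/
theorem choose_neg_eq_prod (r : ℝ) (k : ℕ) :
    (∏ i ∈ Finset.range k, (r + i)) / (k.factorial : ℝ) = (-1) ^ k * Ring.choose (-r) k := by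
  rw [← choose_eq_prod, Ring.choose_neg, Units.smul_def, zsmul_eq_mul, ← mul_assoc]
  rcases Nat.even_or_odd k with h | h
  · simp [Int.negOnePow_even _ (by exact_mod_cast h : Even (k : ℤ)), h.neg_one_pow]
  · simp [Int.negOnePow_odd _ (by exact_mod_cast h : Odd (k : ℤ)), h.neg_one_pow]

theorem sum_antidiagonal_negBinWeight {r s p : ℝ} (hp1 : p < 1) (k : ℕ) :
    ∑ ij ∈ Finset.HasAntidiagonal.antidiagonal k, negBinWeight r p ij.1 * negBinWeight s p ij.2 =
      negBinWeight (r + s) p k := by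
  simp only [negBinWeight, choose_neg_eq_prod]
  rw [neg_add, Ring.add_choose_eq k (Commute.all _ _), Real.rpow_add (by linarith),
    Finset.mul_sum, Finset.sum_mul, Finset.sum_mul]
  refine Finset.sum_congr rfl fun ij hij => ?_
  rw [← Finset.HasAntidiagonal.mem_antidiagonal.1 hij, pow_add, pow_add]
  ring

theorem mul_apply_nat (P Q : PMF ℕ) (k : ℕ) :
    (P * Q) k = ∑ ij ∈ Finset.HasAntidiagonal.antidiagonal k, P ij.1 * Q ij.2 := by
  rw [conv_def, PMF.bind_apply, Finset.Nat.sum_antidiagonal_eq_sum_range_succ_mk]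
  rw [tsum_eq_sum (s := Finset.range k.succ)]
  · refine Finset.sum_congr rfl fun i hi => ?_
    rw [PMF.map_apply, tsum_eq_single (k - i)]
    · have : k = i + (k - i) := by
        have := Finset.mem_range.1 hi
        omega
      simp [← this]
    · intro j hj
      rw [if_neg]; omega
  · intro i hi
    rw [PMF.map_apply]
    have : ∀ j, ¬ k = i + j := by
      intro j
      have := Finset.mem_range.not.1 hi
      omega
    simp [this]

theorem negBin_mul {r s p : ℝ} (hr : 0 < r) (hs : 0 < s) (hp : 0 ≤ p) (hp1 : p < 1) :
    negBin r p * negBin s p = negBin (r + s) p := by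
  ext k
  rw [mul_apply_nat, negBin_apply ⟨by positivity, hp, hp1⟩, ← sum_antidiagonal_negBinWeight hp1,
    ENNReal.ofReal_sum_of_nonneg]
  · refine Finset.sum_congr rfl fun ij _ => ?_
    rw [negBin_apply ⟨hr, hp, hp1⟩, negBin_apply ⟨hs, hp, hp1⟩,
      ENNReal.ofReal_mul (negBinWeight_nonneg hr hp hp1 _)]
  · exact fun ij _ => mul_nonneg (negBinWeight_nonneg hr hp hp1 _)
      (negBinWeight_nonneg hs hp hp1 _)

theorem negBin_pow {r p : ℝ} (hr : 0 < r) (hp : 0 ≤ p) (hp1 : p < 1) (n : ℕ) :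
    negBin r p ^ (n + 1) = negBin ((n + 1) * r) p := by
  induction n with
  | zero => simp
  | succ n ih =>
    rw [pow_succ, ih, negBin_mul (by positivity) hr hp hp1]
    congr 1; push_cast; ring

theorem prod_negBin {r p : ℝ} (hr : 0 < r) (hp : 0 ≤ p) (hp1 : p < 1) {n : ℕ} (hn : 0 < n) :
    ∏ _i : Fin n, negBin (r / n) p = negBin r p := by
  obtain ⟨n, rfl⟩ := Nat.exists_eq_succ_of_ne_zero hn.ne'
  rw [Finset.prod_const, Finset.card_univ, Fintype.card_fin, Nat.succ_eq_add_one,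
    negBin_pow (by positivity) hp hp1]
  congr 1
  push_cast
  field_simp

theorem negBin_one_apply {p : ℝ} (hp : 0 ≤ p) (hp1 : p < 1) (k : ℕ) :
    negBin 1 p k = ENNReal.ofReal ((1 - p) * p ^ k) := by
  have h : ∏ i ∈ Finset.range k, ((1 : ℝ) + i) = k.factorial := by
    rw [← Finset.prod_range_add_one_eq_factorial]; push_cast
    exact Finset.prod_congr rfl fun i _ => add_comm _ _
  rw [negBin_apply ⟨one_pos, hp, hp1⟩, negBinWeight, h, div_self (by positivity), Real.rpow_one,
    one_mul]

theorem negBin_one_tail {p x : ℝ} (hp : 0 < p) (hp1 : p < 1) (hx : 0 ≤ x) :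
    (negBin 1 p).toOuterMeasure {k | x < (k : ℝ)} ≤ ENNReal.ofReal (p ^ x) := by
  classical
  -- This is the first integer exceeding x, so the tail is exactly p^m ≤ p^x.
  set m := ⌊x⌋₊ + 1 with hm
  rw [PMF.toOuterMeasure_apply,
    ← ENNReal.summable.sum_add_tsum_nat_add' (f := Set.indicator _ _) (k := m)]
  have h0 : ∑ i ∈ Finset.range m, Set.indicator {k : ℕ | x < (k : ℝ)} (negBin 1 p) i = 0 := by
    refine Finset.sum_eq_zero fun i hi => Set.indicator_of_notMem ?_ _
    have h1 : i ≤ ⌊x⌋₊ := by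
      have := Finset.mem_range.1 hi
      omega
    simpa using (Nat.le_floor_iff hx).1 h1
  have hs : HasSum (fun k : ℕ => (1 - p) * p ^ (k + m)) (p ^ m) := by
    have := (hasSum_geometric_of_lt_one hp.le hp1).mul_left ((1 - p) * p ^ m)
    rw [mul_assoc, mul_comm (p ^ m), ← mul_assoc, mul_inv_cancel₀ (by linarith), one_mul] at this
    exact this.congr_fun fun k => by ring
  rw [h0, zero_add]
  calc _ ≤ ∑' k : ℕ, ENNReal.ofReal ((1 - p) * p ^ (k + m)) := by
        refine ENNReal.tsum_le_tsum fun k => ?_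
        rw [← negBin_one_apply hp.le hp1]
        exact Set.indicator_le_self _ _ _
    _ = ENNReal.ofReal (p ^ m) := by
        rw [← ENNReal.ofReal_tsum_of_nonneg _ hs.summable, hs.tsum_eq]
        intro k
        have : 0 < 1 - p := by linarith
        positivity
    _ ≤ _ := by
        refine ENNReal.ofReal_le_ofReal ?_
        rw [← Real.rpow_natCast]
        refine Real.rpow_le_rpow_of_exponent_ge hp hp1.le ?_
        rw [hm]; push_cast
        exact (Nat.lt_floor_add_one x).le

/-- Size biasing: (k+1) times the weight of NB(r,p) at k+1 is rp/(1-p) times the weight of NB(r+1,p)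
at k, and the latter weights sum to 1. -/
theorem mean_negBin {r p : ℝ} (hr : 0 < r) (hp : 0 ≤ p) (hp1 : p < 1) :
    mean (negBin r p) (fun k => (k : ℝ≥0∞)) = ENNReal.ofReal (r * p / (1 - p)) := by
  have h1p : 0 < 1 - p := by linarith
  have hw : ∀ k : ℕ, negBinWeight r p (k + 1) * ((k + 1 : ℕ) : ℝ) =
      r * p / (1 - p) * negBinWeight (r + 1) p k := by
    intro k
    simp only [negBinWeight]
    rw [Finset.prod_range_succ', Real.rpow_add h1p, Real.rpow_one, Nat.factorial_succ]
    have : ∏ i ∈ Finset.range k, (r + ((i + 1 : ℕ) : ℝ)) = ∏ i ∈ Finset.range k, (r + 1 + i) :=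
      Finset.prod_congr rfl fun i _ => by push_cast; ring
    rw [this]
    push_cast
    field_simp
    ring
  have hs := (hasSum_negBinWeight (r := r + 1) hp hp1).mul_left (r * p / (1 - p))
  rw [mul_one] at hs
  have hnn : ∀ k, 0 ≤ r * p / (1 - p) * negBinWeight (r + 1) p k := fun k =>
    mul_nonneg (by positivity) (negBinWeight_nonneg (by linarith) hp hp1 k)
  calc mean (negBin r p) (fun k => (k : ℝ≥0∞))
      = ∑' k : ℕ, negBin r p (k + 1) * ((k + 1 : ℕ) : ℝ≥0∞) := by
        rw [mean, tsum_eq_zero_add' ENNReal.summable, Nat.cast_zero, mul_zero, zero_add]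
    _ = ∑' k : ℕ, ENNReal.ofReal (r * p / (1 - p) * negBinWeight (r + 1) p k) := by
        refine tsum_congr fun k => ?_
        rw [negBin_apply ⟨hr, hp, hp1⟩, ← hw, ENNReal.ofReal_mul (negBinWeight_nonneg hr hp hp1 _),
          ENNReal.ofReal_natCast]
    _ = ENNReal.ofReal (r * p / (1 - p)) := by
        rw [← ENNReal.ofReal_tsum_of_nonneg hnn hs.summable, hs.tsum_eq]

/-- Chernoff bound for the lower tail of the negative binomial distribution. -/
theorem negBin_lower_tail {r p z t : ℝ} (hr : 0 < r) (hp : 0 ≤ p) (hp1 : p < 1) (hz : 0 < z)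
    (hz1 : z ≤ 1) :
    (negBin r p).toOuterMeasure {k | (k : ℝ) < t} ≤
      ENNReal.ofReal (z ^ (-t) * ((1 - p) / (1 - p * z)) ^ r) := by
  have hpz : p * z < 1 := by nlinarith
  have hpz0 : 0 ≤ p * z := by positivity
  have h1 : 0 < 1 - p * z := by linarith
  have h2 : 0 < 1 - p := by linarith
  have hs := (hasSum_negBinWeight (r := r) hpz0 hpz).mul_left
    (z ^ (-t) * ((1 - p) / (1 - p * z)) ^ r)
  rw [mul_one] at hs
  have hnn : ∀ k, 0 ≤ z ^ (-t) * ((1 - p) / (1 - p * z)) ^ r * negBinWeight r (p * z) k := by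
    intro k
    have := negBinWeight_nonneg hr hpz0 hpz k
    positivity
  rw [← hs.tsum_eq, ENNReal.ofReal_tsum_of_nonneg hnn hs.summable, PMF.toOuterMeasure_apply]
  refine ENNReal.tsum_le_tsum fun k => ?_
  by_cases hk : k ∈ {k : ℕ | (k : ℝ) < t}
  swap
  · rw [Set.indicator_of_notMem hk]; exact zero_le
  rw [Set.indicator_of_mem hk]
  rw [negBin_apply ⟨hr, hp, hp1⟩]
  refine ENNReal.ofReal_le_ofReal ?_
  have hk' : (k : ℝ) < t := hk
  have hzk : 1 ≤ z ^ (-t) * z ^ k := by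
    rw [← Real.rpow_natCast, ← Real.rpow_add hz]
    exact Real.one_le_rpow_of_pos_of_le_one_of_nonpos hz hz1 (by linarith)
  -- Exponential tilting: z^k times the weight of NB(r,p) is a constant multiple of the weight of
  -- NB(r,pz). For k < t and z ≤ 1 the factor z^{k-t} is at least 1.
  have e : z ^ (-t) * ((1 - p) / (1 - p * z)) ^ r * negBinWeight r (p * z) k =
      negBinWeight r p k * (z ^ (-t) * z ^ k) := by
    rw [negBinWeight, negBinWeight, Real.div_rpow h2.le h1.le, mul_pow]
    field_simp
  rw [e]
  exact le_mul_of_one_le_right (negBinWeight_nonneg hr hp hp1 k) hzk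

/-! ### The noise of `BaseSumDP` -/

/-- The additive homomorphism `c ↦ (c, c)`. -/
def diagHom : ℕ →+ ℕ × ℕ := (AddMonoidHom.id ℕ).prod (AddMonoidHom.id ℕ)

/-- The multiset with `u` messages `1` and `v` messages `-1`. -/
def messagesHom : ℕ × ℕ →+ Multiset ℤˣ :=
  (Multiset.replicateAddMonoidHom 1).coprod (Multiset.replicateAddMonoidHom (-1))

theorem messagesHom_apply (u v : ℕ) :
    messagesHom (u, v) = Multiset.replicate u 1 + Multiset.replicate v (-1) := rfl

/-- The joint law of the numbers of noise messages `1` and `-1`. -/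
def pairNoise (r p R q : ℝ) : PMF (ℕ × ℕ) :=
  mapHom (AddMonoidHom.inl ℕ ℕ) (negBin r p) * mapHom (AddMonoidHom.inr ℕ ℕ) (negBin r p) *
    mapHom diagHom (negBin R q)

/-- The total noise of `BaseSumDP` over all users. -/
def baseNoise (ε δ : ℝ) : PMF (ℕ × ℕ) :=
  pairNoise 1 (Real.exp (-((1 - 0.1) * ε))) (3 * (1 + Real.log (1 / δ)))
    (Real.exp (-(0.2 * (0.1 * ε))))

/-- What the analyzer receives from an instance of `BaseSumDP` with true sum `B`. -/
def baseView (ε δ : ℝ) (B : ℕ) : PMF (Multiset ℤˣ) :=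
  mapHom messagesHom (PMF.pure (B, 0) * baseNoise ε δ)

theorem baseSumRandomizer_eq (n : ℕ) (ε δ lam : ℝ) (x : Bool) :
    baseSumRandomizer n ε δ lam x = mapHom messagesHom (PMF.pure (x.toNat, 0) *
      pairNoise (1 / n) (Real.exp (-((1 - lam) * ε))) (3 * (1 + Real.log (1 / δ)) / n)
        (Real.exp (-(0.2 * (lam * ε))))) := by
  simp only [baseSumRandomizer, pairNoise, mapHom_apply, conv_def, PMF.pure_bind, PMF.map,
    PMF.bind_bind, Function.comp_def]
  congr 1; funext a
  congr 1; funext b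
  congr 1; funext c
  rw [AddMonoidHom.inl_apply, AddMonoidHom.inr_apply]
  simp only [diagHom, AddMonoidHom.prod_apply, AddMonoidHom.id_apply, Prod.mk_add_mk, zero_add,
    messagesHom_apply, add_zero, Multiset.replicate_add]

theorem exp_neg_lt_one {x : ℝ} (hx : 0 < x) : Real.exp (-x) < 1 := by
  rw [Real.exp_lt_one_iff]; linarith

theorem three_le_noiseShape {δ : ℝ} (hδ : 0 < δ) (hδ1 : δ ≤ 1) :
    3 ≤ 3 * (1 + Real.log (1 / δ)) := by
  have : 0 ≤ Real.log (1 / δ) := Real.log_nonneg (by rw [le_div_iff₀ hδ]; linarith)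
  linarith

/-- Infinite divisibility: n shares of shape r/n convolve to shape r, and the inputs, being point
masses, add up. The noise seen by the analyzer therefore does not depend on n. -/
theorem prod_baseSumRandomizer {n : ℕ} (hn : 0 < n) {ε δ : ℝ} (hε : 0 < ε) (hδ : 0 < δ)
    (hδ1 : δ ≤ 1) (x : Fin n → Bool) :
    ∏ i, baseSumRandomizer n ε δ 0.1 (x i) = baseView ε δ (∑ i, (x i).toNat) := by
  have hR := three_le_noiseShape hδ hδ1
  have hp := exp_neg_lt_one (x := (1 - 0.1) * ε) (by linarith)
  have hq := exp_neg_lt_one (x := 0.2 * (0.1 * ε)) (by linarith)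
  simp only [baseSumRandomizer_eq, ← map_prod, baseView, baseNoise]
  congr 1
  rw [Finset.prod_mul_distrib, prod_pure]
  congr 1
  · congr 1
    ext <;> simp [Prod.fst_sum, Prod.snd_sum]
  · simp only [pairNoise, Finset.prod_mul_distrib, ← map_prod]
    rw [prod_negBin one_pos (Real.exp_pos _).le hp hn,
      prod_negBin (by linarith) (Real.exp_pos _).le hq hn]

/-! ### Point masses of the noise pair, given the number of cancelling pairs. -/

section Shift

variable {M : Type*} [AddCommMonoid M]

theorem pure_mul_eq_map (m : M) (P : PMF M) : PMF.pure m * P = P.map fun t => m + t := by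
  rw [conv_def, PMF.pure_bind]

theorem map_apply_of_injective {Ω Ω' : Type*} (P : PMF Ω) {f : Ω → Ω'}
    (hf : Function.Injective f) (x : Ω) : P.map f (f x) = P x := by
  classical
  rw [PMF.map_apply, tsum_eq_single x]
  · simp
  · intro y hy
    rw [if_neg]
    exact fun h => hy (hf h).symm

theorem map_apply_of_notMem {Ω Ω' : Type*} (P : PMF Ω) {f : Ω → Ω'} {y : Ω'}
    (hy : ∀ x, f x ≠ y) : P.map f y = 0 := by
  classical
  rw [PMF.map_apply]
  simp [fun x => (hy x).symm]

end Shift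

theorem inl_mul_inr_apply (P Q : PMF ℕ) (u v : ℕ) :
    (mapHom (AddMonoidHom.inl ℕ ℕ) P * mapHom (AddMonoidHom.inr ℕ ℕ) Q) (u, v) = P u * Q v := by
  rw [conv_def, mapHom_apply, PMF.bind_map, PMF.bind_apply, tsum_eq_single u]
  · simp only [Function.comp_apply, mapHom_apply, PMF.map_comp]
    congr 1
    exact map_apply_of_injective Q (f := (fun t => AddMonoidHom.inl ℕ ℕ u + t) ∘
      AddMonoidHom.inr ℕ ℕ) (fun a b h => by simpa using h) v ▸ by simp
  · intro a ha
    simp only [Function.comp_apply, mapHom_apply, PMF.map_comp]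
    rw [map_apply_of_notMem, mul_zero]
    intro b hb
    simp at hb
    exact ha hb.1

/-- The law of the noise messages, conditioned on the number of cancelling pairs. -/
def shiftedGeom (p : ℝ) (c : ℕ) : PMF (ℕ × ℕ) :=
  PMF.pure (diagHom c) *
    (mapHom (AddMonoidHom.inl ℕ ℕ) (negBin 1 p) * mapHom (AddMonoidHom.inr ℕ ℕ) (negBin 1 p))

theorem pairNoise_eq_bind (p R q : ℝ) :
    pairNoise 1 p R q = (negBin R q).bind (shiftedGeom p) := by
  rw [pairNoise, mul_comm, conv_def, mapHom_apply, PMF.bind_map]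
  congr 1
  funext c
  rw [shiftedGeom, pure_mul_eq_map]; rfl

theorem shiftedGeom_apply (p : ℝ) (c u v : ℕ) :
    shiftedGeom p c (u, v) =
      if c ≤ u ∧ c ≤ v then negBin 1 p (u - c) * negBin 1 p (v - c) else 0 := by
  rw [shiftedGeom, pure_mul_eq_map]
  split_ifs with h
  · have e : (u, v) = diagHom c + (u - c, v - c) := by
      simp [diagHom, h.1, h.2]
    conv_lhs => rw [e]
    rw [map_apply_of_injective _ (fun a b h => by simpa using h), inl_mul_inr_apply]
  · rw [map_apply_of_notMem]
    rintro ⟨a, b⟩ hab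
    simp [diagHom] at hab
    exact h ⟨by omega, by omega⟩

theorem negBin_one_le_succ {p E : ℝ} (hp : 0 ≤ p) (hp1 : p < 1) (hE : 1 ≤ E * p) (k : ℕ) :
    negBin 1 p k ≤ ENNReal.ofReal E * negBin 1 p (k + 1) := by
  have hE0 : 0 ≤ E := by
    by_contra h
    nlinarith [not_le.1 h]
  rw [negBin_one_apply hp hp1, negBin_one_apply hp hp1, ← ENNReal.ofReal_mul hE0]
  refine ENNReal.ofReal_le_ofReal ?_
  have h : 0 ≤ (1 - p) * p ^ k := mul_nonneg (by linarith) (by positivity)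
  calc (1 - p) * p ^ k ≤ (1 - p) * p ^ k * (E * p) := le_mul_of_one_le_right h hE
    _ = _ := by ring

/-- The ratio of consecutive weights of NB(R,q) at c+1 and c is q(R+c)/(c+1). -/
theorem negBin_succ_le {R q E : ℝ} (hR : 0 < R) (hq : 0 ≤ q) (hq1 : q < 1) (hE : 0 ≤ E) {c : ℕ}
    (h : q * (R + c) ≤ E * (c + 1)) :
    negBin R q (c + 1) ≤ ENNReal.ofReal E * negBin R q c := by
  rw [negBin_apply ⟨hR, hq, hq1⟩, negBin_apply ⟨hR, hq, hq1⟩, ← ENNReal.ofReal_mul hE]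
  refine ENNReal.ofReal_le_ofReal ?_
  have e : negBinWeight R q (c + 1) = q * (R + c) / (c + 1) * negBinWeight R q c := by
    simp only [negBinWeight]
    rw [Finset.prod_range_succ, Nat.factorial_succ]
    push_cast
    field_simp
    ring
  rw [e]
  refine mul_le_mul_of_nonneg_right ?_ (negBinWeight_nonneg hR hq hq1 c)
  rw [div_le_iff₀ (by positivity)]
  exact h

/-- Changing the true sum by one is hidden by the noise. -/
theorem indist_pairNoise {p R q E₁ E₂ t ε : ℝ} (hp : 0 ≤ p) (hp1 : p < 1) (hR : 0 < R)
    (hq : 0 ≤ q) (hq1 : q < 1) (hE₁ : 1 ≤ E₁ * p) (hE₂ : 1 ≤ E₂) (hε : E₁ * E₂ ≤ Real.exp ε)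
    (hε0 : 0 ≤ ε) (ht : 0 < t) (hratio : ∀ c : ℕ, t ≤ c + 1 → q * (R + c) ≤ E₂ * (c + 1)) :
    Indist ε ((negBin R q).toOuterMeasure {k | (k : ℝ) < t})
      (PMF.pure (1, 0) * pairNoise 1 p R q) (pairNoise 1 p R q) := by
  classical
  have hE₁0 : 0 ≤ E₁ := by
    by_contra h
    nlinarith [not_le.1 h]
  have hE1ε : ENNReal.ofReal E₁ ≤ ENNReal.ofReal (Real.exp ε) :=
    ENNReal.ofReal_le_ofReal (by nlinarith)
  set C := negBin R q with hC
  -- The removed mass is the event that there are fewer than t cancelling pairs. Beyond it, a step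
  -- of C upwards costs at most E₂.
  set C' : ℕ → ℝ≥0∞ := fun c => if (c : ℝ) < t then 0 else C c with hC'
  have hC'C : ∀ c, C' c ≤ C c := fun c => by
    simp only [hC']; split_ifs
    · exact zero_le
    · exact le_rfl
  have hW : ∀ x, pairNoise 1 p R q x = ∑' c, C c * shiftedGeom p c x := fun x => by
    rw [pairNoise_eq_bind, PMF.bind_apply]
  have hinj : Function.Injective fun x : ℕ × ℕ => ((1, 0) : ℕ × ℕ) + x := fun a b h => by
    simpa using h
  have hP0 : ∀ v, (PMF.pure ((1, 0) : ℕ × ℕ) * pairNoise 1 p R q) (0, v) = 0 := fun v => by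
    rw [pure_mul_eq_map, map_apply_of_notMem]
    rintro ⟨a, b⟩ h
    simp at h
  have hPs : ∀ u v, (PMF.pure ((1, 0) : ℕ × ℕ) * pairNoise 1 p R q) (u + 1, v) =
      ∑' c, C c * shiftedGeom p c (u, v) := fun u v => by
    have e : (u + 1, v) = ((1, 0) : ℕ × ℕ) + (u, v) := by simp [add_comm]
    rw [pure_mul_eq_map, e, map_apply_of_injective _ hinj, hW]
  refine indist_of_le hε0 ?_ (fun x => ∑' c, C' c * shiftedGeom p c x) ?_ ?_ ?_
  · rintro ⟨u | u, v⟩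
    · rw [hP0]; exact zero_le
    · rw [hPs, hW, ← ENNReal.tsum_mul_left]
      refine ENNReal.tsum_le_tsum fun c => ?_
      rw [mul_left_comm]
      gcongr
      rw [shiftedGeom_apply, shiftedGeom_apply]
      by_cases h : c ≤ u ∧ c ≤ v
      · rw [if_pos h, if_pos ⟨by omega, h.2⟩, ← mul_assoc]
        gcongr
        rw [show u + 1 - c = u - c + 1 by omega]
        exact (negBin_one_le_succ hp hp1 hE₁ _).trans (by gcongr)
      · rw [if_neg h]; exact zero_le
  · intro x
    rw [hW]
    exact ENNReal.tsum_le_tsum fun c => by gcongr; exact hC'C c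
  -- The law shifted by (1,0) gives no mass to u = 0. There the unshifted noise must have c = 0,
  -- which truncation removes because t > 0.
  · have hC'0 : C' 0 = 0 := by simp [hC', ht]
    rintro ⟨u | u, v⟩
    · rw [hP0, mul_zero, nonpos_iff_eq_zero, ENNReal.tsum_eq_zero]
      intro c
      rcases Nat.eq_zero_or_pos c with rfl | hc
      · rw [hC'0, zero_mul]
      · rw [shiftedGeom_apply, if_neg (by omega), mul_zero]
    · rw [hPs, ← ENNReal.tsum_mul_left, tsum_eq_zero_add' ENNReal.summable, hC'0, zero_mul,
        zero_add]
      refine ENNReal.tsum_le_tsum fun c => ?_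
      -- The count c+1 at (u+1,v) is compared with c at (u,v): the first geometric variable keeps
      -- its value u-c, the second grows by one at a cost E₁, and the change of c costs E₂.
      have h1 : C' (c + 1) ≤ ENNReal.ofReal E₂ * C c := by
        simp only [hC']
        split_ifs with h
        · exact zero_le
        · exact negBin_succ_le hR hq hq1 (by linarith)
            (hratio c (by push_cast at h; linarith))
      have h2 : shiftedGeom p (c + 1) (u + 1, v) ≤
          ENNReal.ofReal E₁ * shiftedGeom p c (u, v) := by
        rw [shiftedGeom_apply, shiftedGeom_apply]
        by_cases h : c + 1 ≤ u + 1 ∧ c + 1 ≤ v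
        · rw [if_pos h, if_pos ⟨by omega, by omega⟩, mul_left_comm,
            show u + 1 - (c + 1) = u - c by omega, show v - c = v - (c + 1) + 1 by omega]
          gcongr
          exact negBin_one_le_succ hp hp1 hE₁ _
        · rw [if_neg h]; exact zero_le
      calc C' (c + 1) * shiftedGeom p (c + 1) (u + 1, v)
          ≤ (ENNReal.ofReal E₂ * C c) * (ENNReal.ofReal E₁ * shiftedGeom p c (u, v)) := by gcongr
        _ = ENNReal.ofReal (E₁ * E₂) * (C c * shiftedGeom p c (u, v)) := by
            rw [ENNReal.ofReal_mul hE₁0]; ring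
        _ ≤ _ := by gcongr
  · rw [ENNReal.tsum_comm]
    simp only [ENNReal.tsum_mul_left, PMF.tsum_coe, mul_one]
    rw [PMF.toOuterMeasure_apply, ← ENNReal.tsum_add, ← C.tsum_coe]
    refine ENNReal.tsum_le_tsum fun c => ?_
    simp only [hC', Set.indicator_apply, Set.mem_ofPred_eq]
    split_ifs <;> simp

/-! ### Privacy of one instance of `BaseSumDP` -/

theorem exp_three_halves_le : Real.exp (3 / 2) ≤ 4.6 := by
  have h1 : Real.exp (3 / 2) ^ 2 ≤ 4.6 ^ 2 := by
    rw [← Real.exp_nat_mul]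
    have e : Real.exp (((2 : ℕ) : ℝ) * (3 / 2)) = Real.exp 1 ^ 3 := by
      rw [← Real.exp_nat_mul]; congr 1; norm_num
    rw [e]
    calc Real.exp 1 ^ 3 ≤ 2.7182818286 ^ 3 := by gcongr; exact Real.exp_one_lt_d9.le
      _ ≤ _ := by norm_num
  exact le_of_sq_le_sq h1 (by norm_num)

theorem exp_neg_two_le : Real.exp (-2) ≤ 1 / 5 := by
  rw [Real.exp_neg, inv_eq_one_div]
  refine one_div_le_one_div_of_le (by norm_num) ?_
  have e : Real.exp 2 = Real.exp 1 ^ 2 := by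
    rw [← Real.exp_nat_mul]; congr 1; norm_num
  rw [e]
  calc (5 : ℝ) ≤ 2.7182818283 ^ 2 := by norm_num
    _ ≤ _ := by gcongr; exact Real.exp_one_gt_d9.le

/-- The number of cancelling pairs is large enough except with probability `δ / 20`. -/
theorem cancelling_pairs_tail {x δ : ℝ} (hx : 0 < x) (hx1 : x ≤ 1 / 2) (hδ : 0 < δ)
    (hδ1 : δ ≤ 1 / 4) :
    (negBin (3 * (1 + Real.log (1 / δ))) (Real.exp (-(0.2 * x)))).toOuterMeasure
      {k | (k : ℝ) < (3 * (1 + Real.log (1 / δ)) - 1) / (Real.exp (1.2 * x) - 1)} ≤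
      ENNReal.ofReal (δ / 20) := by
  have hR := three_le_noiseShape hδ (by linarith)
  set R := 3 * (1 + Real.log (1 / δ)) with hRdef
  have hy1 : Real.exp (-(0.2 * x)) < 1 := exp_neg_lt_one (by linarith)
  refine (negBin_lower_tail (z := Real.exp (-x)) (by linarith) (Real.exp_pos _).le hy1
    (Real.exp_pos _) (exp_neg_lt_one hx).le).trans (ENNReal.ofReal_le_ofReal ?_)
  have hy9 : 0.9 ≤ Real.exp (-(0.2 * x)) := by
    have := Real.add_one_le_exp (-(0.2 * x)); linarith
  -- With q = e^{-0.2x}, the tilt z = e^{-x} is q^5. The Chernoff base (1-q)/(1-q^6) is then the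
  -- reciprocal of 1+q+…+q^5, which is at least 4.6 because q ≥ 0.9.
  have hz : Real.exp (-(0.2 * x)) * Real.exp (-x) = Real.exp (-(0.2 * x)) ^ 6 := by
    rw [← Real.exp_add, ← Real.exp_nat_mul]; congr 1; push_cast; ring
  rw [hz]
  have hratio : (1 - Real.exp (-(0.2 * x))) / (1 - Real.exp (-(0.2 * x)) ^ 6) ≤
      Real.exp (-(3 / 2)) := by
    generalize Real.exp (-(0.2 * x)) = y at hy1 hy9
    have h6 : 1 - y ^ 6 = (1 - y) * (1 + y + y ^ 2 + y ^ 3 + y ^ 4 + y ^ 5) := by ring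
    have hs : 4.6 ≤ 1 + y + y ^ 2 + y ^ 3 + y ^ 4 + y ^ 5 := by
      calc (4.6 : ℝ) ≤ 1 + 0.9 + 0.9 ^ 2 + 0.9 ^ 3 + 0.9 ^ 4 + 0.9 ^ 5 := by norm_num
        _ ≤ _ := by gcongr
    have h1y : 0 < 1 - y := by linarith
    rw [h6, div_mul_eq_div_div, div_self h1y.ne', Real.exp_neg, inv_eq_one_div]
    exact one_div_le_one_div_of_le (Real.exp_pos _) (exp_three_halves_le.trans hs)
  have hratio0 : 0 ≤ (1 - Real.exp (-(0.2 * x))) / (1 - Real.exp (-(0.2 * x)) ^ 6) := by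
    have : Real.exp (-(0.2 * x)) ^ 6 ≤ 1 := pow_le_one₀ (Real.exp_pos _).le hy1.le
    exact div_nonneg (by linarith) (by linarith)
  have hpow : ((1 - Real.exp (-(0.2 * x))) / (1 - Real.exp (-(0.2 * x)) ^ 6)) ^ R ≤
      Real.exp (-(3 / 2) * R) := by
    rw [Real.exp_mul]
    exact Real.rpow_le_rpow hratio0 hratio (by linarith)
  have hthr : Real.exp (-x) ^ (-((R - 1) / (Real.exp (1.2 * x) - 1))) ≤
      Real.exp (5 / 6 * R) := by
    rw [← Real.exp_mul, Real.exp_le_exp]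
    have h1 : 1.2 * x ≤ Real.exp (1.2 * x) - 1 := by
      have := Real.add_one_le_exp (1.2 * x); linarith
    have h2 : (R - 1) / (Real.exp (1.2 * x) - 1) ≤ R / (1.2 * x) :=
      div_le_div₀ (by linarith) (by linarith) (by linarith) h1
    calc -x * -((R - 1) / (Real.exp (1.2 * x) - 1))
        = x * ((R - 1) / (Real.exp (1.2 * x) - 1)) := by ring
      _ ≤ x * (R / (1.2 * x)) := by gcongr
      _ = 5 / 6 * R := by field_simp; norm_num
  -- The exponent is (5/6 - 3/2)R = -(2/3)R = -2 - 2 ln(1/δ). This yields e^{-2}δ², and one factor δ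
  -- ≤ 1/4 is spent on the constant.
  calc _ ≤ Real.exp (5 / 6 * R) * Real.exp (-(3 / 2) * R) := by gcongr
    _ = Real.exp (-2) * (Real.exp (Real.log δ) * Real.exp (Real.log δ)) := by
        rw [← Real.exp_add, ← Real.exp_add, ← Real.exp_add, hRdef, one_div, Real.log_inv]
        congr 1; ring
    _ = Real.exp (-2) * (δ * δ) := by rw [Real.exp_log hδ]
    _ ≤ 1 / 5 * (1 / 4 * δ) := by gcongr; exact exp_neg_two_le
    _ = δ / 20 := by ring

/-- The budget splits as 0.9ε for the geometric variables and 0.1ε for the cancelling pairs. The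
threshold t is where the ratio of consecutive weights of the pairs falls to e^{0.1ε}: with x = 0.1ε,
the condition reads R + c ≤ e^{1.2x}(c+1). -/
theorem indist_baseNoise {ε δ : ℝ} (hε : 0 < ε) (hε1 : ε ≤ 5) (hδ : 0 < δ) (hδ1 : δ ≤ 1 / 4) :
    Indist ε (ENNReal.ofReal (δ / 20)) (PMF.pure (1, 0) * baseNoise ε δ) (baseNoise ε δ) := by
  have hR := three_le_noiseShape hδ (by linarith)
  have htail := cancelling_pairs_tail (x := 0.1 * ε) (by linarith) (by linarith) hδ hδ1
  have hexp : 0 < Real.exp (1.2 * (0.1 * ε)) - 1 := by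
    have := Real.add_one_le_exp (1.2 * (0.1 * ε)); linarith
  have h := indist_pairNoise (p := Real.exp (-((1 - 0.1) * ε)))
    (R := 3 * (1 + Real.log (1 / δ))) (q := Real.exp (-(0.2 * (0.1 * ε))))
    (E₁ := Real.exp ((1 - 0.1) * ε)) (E₂ := Real.exp (0.1 * ε))
    (t := (3 * (1 + Real.log (1 / δ)) - 1) / (Real.exp (1.2 * (0.1 * ε)) - 1)) (ε := ε)
    (Real.exp_pos _).le (exp_neg_lt_one (by linarith)) (by linarith) (Real.exp_pos _).le
    (exp_neg_lt_one (by linarith)) (by rw [← Real.exp_add]; simp)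
    (Real.one_le_exp (by linarith)) (by rw [← Real.exp_add]; apply le_of_eq; congr 1; ring)
    hε.le (div_pos (by linarith) hexp) ?_
  · obtain ⟨P', Q', h1, h2, h3, h4, h5⟩ := h
    exact ⟨P', Q', h1, h2, h3, h4.trans (by gcongr), h5⟩
  · intro c hc
    rw [div_le_iff₀ hexp] at hc
    generalize 3 * (1 + Real.log (1 / δ)) = R at hc hR
    have e : Real.exp (0.1 * ε) = Real.exp (-(0.2 * (0.1 * ε))) * Real.exp (1.2 * (0.1 * ε)) := by
      rw [← Real.exp_add]; congr 1; ring
    rw [e, mul_assoc]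
    refine mul_le_mul_of_nonneg_left ?_ (Real.exp_pos _).le
    linarith

/-- Instances whose input bit is unchanged are charged nothing. The sum m of the other users' bits
is only a common shift. -/
theorem indist_baseView {ε δ : ℝ} (hε : 0 < ε) (hε1 : ε ≤ 5) (hδ : 0 < δ) (hδ1 : δ ≤ 1 / 4)
    (m : ℕ) (b b' : Bool) :
    Indist (if b = b' then 0 else ε) (if b = b' then 0 else ENNReal.ofReal (δ / 20))
      (baseView ε δ (m + b.toNat)) (baseView ε δ (m + b'.toNat)) := by
  have h : Indist ε (ENNReal.ofReal (δ / 20)) (baseView ε δ (m + 1)) (baseView ε δ m) := by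
    have := ((indist_baseNoise hε hε1 hδ hδ1).mul_left (m, 0)).map messagesHom
    rwa [← mul_assoc, pure_mul_pure] at this
  cases b <;> cases b'
  · simpa using Indist.refl _
  · simpa using h.symm
  · simpa using h
  · simpa using Indist.refl _

/-! ### Numerical bounds for the composition -/

/-- The best constant is the maximum (1/(1+α))·(α/(1+α))^α of (1-T)T^α over [0,1]; the second factor
is relaxed to e^{-κ} using log(1+x) ≥ 2x/(x+2). The maximum comes from u ≤ e^{u-1}, applied to
(1-T)(1+α) and to T(1+α)/α, whose exponents cancel. -/
theorem one_le_add_rpow_neg {α κ : ℝ} (hα : 0 < α) (hκ : κ = 2 * α / (2 * α + 1)) {T : ℝ}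
    (hT : 0 < T) : 1 ≤ T + Real.exp (-κ) / (1 + α) * T ^ (-α) := by
  have hc : 0 < Real.exp (-κ) / (1 + α) := by positivity
  rcases le_or_gt 1 T with h | h
  · have : 0 ≤ Real.exp (-κ) / (1 + α) * T ^ (-α) := by positivity
    linarith
  have h1 : (1 - T) * (1 + α) ≤ Real.exp ((1 - T) * (1 + α) - 1) := by
    have := Real.add_one_le_exp ((1 - T) * (1 + α) - 1); linarith
  have h2 : T * ((1 + α) / α) ≤ Real.exp (T * ((1 + α) / α) - 1) := by
    have := Real.add_one_le_exp (T * ((1 + α) / α) - 1); linarith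
  have h3 : T ^ α * ((1 + α) / α) ^ α ≤ Real.exp (T * (1 + α) - α) := by
    rw [← Real.mul_rpow hT.le (by positivity)]
    calc _ ≤ Real.exp (T * ((1 + α) / α) - 1) ^ α :=
          Real.rpow_le_rpow (by positivity) h2 hα.le
      _ = _ := by rw [← Real.exp_mul]; congr 1; field_simp
  have h4 : Real.exp κ ≤ ((1 + α) / α) ^ α := by
    have hl := Real.le_log_one_add_of_nonneg (x := 1 / α) (by positivity)
    have e : 1 + 1 / α = (1 + α) / α := by field_simp; ring
    rw [e] at hl
    rw [Real.rpow_def_of_pos (by positivity), Real.exp_le_exp, hκ]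
    calc 2 * α / (2 * α + 1) = 2 * (1 / α) / (1 / α + 2) * α := by field_simp; ring
      _ ≤ _ := by gcongr
  have h5 : (1 - T) * (1 + α) * (T ^ α * Real.exp κ) ≤ 1 := by
    calc (1 - T) * (1 + α) * (T ^ α * Real.exp κ)
        ≤ Real.exp ((1 - T) * (1 + α) - 1) * Real.exp (T * (1 + α) - α) := by
          refine mul_le_mul h1 (le_trans ?_ h3) (by positivity) (Real.exp_pos _).le
          gcongr
      _ = 1 := by rw [← Real.exp_add, Real.exp_eq_one_iff]; ring
  have h6 : 1 - T ≤ Real.exp (-κ) / (1 + α) * T ^ (-α) := by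
    rw [Real.exp_neg, Real.rpow_neg hT.le]
    have : 0 < T ^ α := Real.rpow_pos_of_pos hT α
    have hk := Real.exp_pos κ
    rw [show (Real.exp κ)⁻¹ / (1 + α) * (T ^ α)⁻¹ = 1 / ((1 + α) * (T ^ α * Real.exp κ)) by
      field_simp, le_div_iff₀ (by positivity)]
    linarith
  linarith

theorem exp_le_one_point_eight : Real.exp 0.55 ≤ 1.8 := by
  have h : Real.exp 0.55 ^ 20 ≤ 1.8 ^ 20 := by
    rw [← Real.exp_nat_mul]
    have e : Real.exp (((20 : ℕ) : ℝ) * 0.55) = Real.exp 1 ^ 11 := by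
      rw [← Real.exp_nat_mul]; congr 1; norm_num
    rw [e]
    calc Real.exp 1 ^ 11 ≤ 2.7182818286 ^ 11 := by gcongr; exact Real.exp_one_lt_d9.le
      _ ≤ _ := by norm_num
  exact le_of_pow_le_pow_left₀ (by norm_num) (by norm_num) h

/-- If the coefficient of L is not positive, every term is at most 0. Otherwise L may be replaced by
its largest value 1.25/w, which leaves a polynomial inequality in w on (0, 0.625]. -/
theorem exponent_le {L w : ℝ} (hL : 2 ≤ L) (hw : 0 < w) (hLw : L * w ≤ 1.25) :
    L * (Real.log 2 - (1 - w) ^ 2) - (1 - w) - (1 - w) / (1 + w) ≤ 0.55 := by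
  have hw1 : w ≤ 0.625 := by nlinarith
  have hl : Real.log 2 ≤ 0.6932 := by linarith [Real.log_two_lt_d9]
  have h0 : 0 ≤ (1 - w) / (1 + w) := div_nonneg (by linarith) (by linarith)
  rcases le_or_gt (Real.log 2 - (1 - w) ^ 2) 0 with h | h
  · nlinarith
  have hL' : L ≤ 1.25 / w := by rw [le_div_iff₀ hw]; exact hLw
  have h1 : L * (Real.log 2 - (1 - w) ^ 2) ≤ 1.25 / w * (0.6932 - (1 - w) ^ 2) := by
    refine mul_le_mul hL' (by linarith) h.le (by positivity)
  have hpoly : 1.25 * (0.6932 - (1 - w) ^ 2) * (1 + w) - w * (1 - w) * (1 + w) - w * (1 - w) ≤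
      0.55 * w * (1 + w) := by
    nlinarith [mul_nonneg hw.le (sub_nonneg.2 hw1), mul_nonneg (mul_nonneg hw.le hw.le)
      (sub_nonneg.2 hw1), sq_nonneg (w - 0.625)]
  have h2 : 1.25 / w * (0.6932 - (1 - w) ^ 2) - (1 - w) - (1 - w) / (1 + w) ≤ 0.55 := by
    have h1w : 0 < 1 + w := by linarith
    have e : 1.25 / w * (0.6932 - (1 - w) ^ 2) - (1 - w) - (1 - w) / (1 + w) =
        (1.25 * (0.6932 - (1 - w) ^ 2) * (1 + w) - w * (1 - w) * (1 + w) - w * (1 - w)) /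
          (w * (1 + w)) := by field_simp
    rw [e, div_le_iff₀ (by positivity)]
    linarith
  linarith

/-- The choice of the Rényi order for the composition of the coordinate instances. -/
theorem exists_renyi_order {ε δ : ℝ} (hε : 0 < ε) (hε1 : ε ≤ 10) (hδ : 0 < δ) (hδ1 : δ ≤ 1 / 2) :
    ∃ α c : ℝ, 0 < α ∧ 0 ≤ c ∧ (∀ T : ℝ, 0 < T → 1 ≤ T + c * T ^ (-α)) ∧
      ∀ N : ℝ, 1 ≤ N →
        Real.exp (N * (α * (α + 1) / 2 * (ε ^ 2 / (8 * Real.logb 2 (2 / δ))))) * c *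
          Real.exp (N * (ε / 2)) ^ (-α) ≤ 0.9 * δ := by
  set L := Real.logb 2 (2 / δ) with hLdef
  have hL : 2 ≤ L := by
    rw [hLdef, Real.le_logb_iff_rpow_le (by norm_num) (by positivity), le_div_iff₀ hδ]
    norm_num; linarith
  have hδL : δ = 2 * Real.exp (-(L * Real.log 2)) := by
    rw [Real.exp_neg, hLdef, Real.logb, div_mul_cancel₀ _ (Real.log_pos (by norm_num)).ne',
      Real.exp_log (by positivity)]
    field_simp
  -- In these terms ε = 8Lw, so ε ≤ 10 becomes Lw ≤ 1.25. The order α below minimizes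
  -- α(α+1)/2·ε²/(8L) - αε/2; the minimum is -L(1-w)².
  set w := ε / (8 * L) with hwdef
  have hw : 0 < w := by positivity
  have hεw : ε = 8 * L * w := by rw [hwdef]; field_simp
  have hLw : L * w ≤ 1.25 := by nlinarith
  have hw1 : w ≤ 0.625 := by nlinarith
  set α := (1 - w) / (2 * w) with hα
  have hα0 : 0 < α := div_pos (by linarith) (by linarith)
  have hκ : 1 - w = 2 * α / (2 * α + 1) := by
    rw [hα]; field_simp; ring
  refine ⟨α, Real.exp (-(1 - w)) / (1 + α), hα0, by positivity,
    fun T hT => one_le_add_rpow_neg hα0 hκ hT, fun N hN => ?_⟩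
  have hX : α * (α + 1) / 2 * (ε ^ 2 / (8 * L)) - α * (ε / 2) = -(L * (1 - w) ^ 2) := by
    rw [hεw, hα]; field_simp; ring
  have h1 : Real.exp (N * (α * (α + 1) / 2 * (ε ^ 2 / (8 * L)))) *
      Real.exp (N * (ε / 2)) ^ (-α) = Real.exp (N * -(L * (1 - w) ^ 2)) := by
    rw [← hX, ← Real.exp_mul, ← Real.exp_add]; congr 1; ring
  have h2 : 1 / (1 + α) ≤ Real.exp (-((1 - w) / (1 + w))) := by
    have := Real.add_one_le_exp (-((1 - w) / (1 + w)))
    refine le_trans (le_of_eq ?_) this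
    have e : 1 + α = (1 + w) / (2 * w) := by rw [hα]; field_simp; ring
    have h1w : 1 + w ≠ 0 := by linarith
    rw [e]; field_simp; ring
  calc _ = (Real.exp (N * (α * (α + 1) / 2 * (ε ^ 2 / (8 * L)))) *
        Real.exp (N * (ε / 2)) ^ (-α)) * (Real.exp (-(1 - w)) * (1 / (1 + α))) := by ring
    _ = Real.exp (N * -(L * (1 - w) ^ 2)) * (Real.exp (-(1 - w)) * (1 / (1 + α))) := by rw [h1]
    _ ≤ Real.exp (1 * -(L * (1 - w) ^ 2)) *
          (Real.exp (-(1 - w)) * Real.exp (-((1 - w) / (1 + w)))) := by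
        refine mul_le_mul (Real.exp_le_exp.2 ?_) (by gcongr) (by positivity) (by positivity)
        have : 0 ≤ L * (1 - w) ^ 2 := by positivity
        nlinarith
    _ = Real.exp (L * (Real.log 2 - (1 - w) ^ 2) - (1 - w) - (1 - w) / (1 + w)) *
          Real.exp (-(L * Real.log 2)) := by
        simp only [← Real.exp_add]; congr 1; ring
    -- Since δ = 2e^{-L ln 2}, a prefactor 1.8 gives 0.9δ and leaves room for the masses removed in
    -- the instances.
    _ ≤ 1.8 * Real.exp (-(L * Real.log 2)) := by
        gcongr
        exact (Real.exp_le_exp.2 (exponent_le hL hw hLw)).trans exp_le_one_point_eight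
    _ = 0.9 * δ := by rw [hδL]; ring

/-! ### The view of the analyzer -/

/-- The first privacy parameter of an instance. -/
def instanceEps {d : ℕ} (ε δ : ℝ) : Instance d → ℝ
  | (_, none) => ε / 2
  | (j, some _) => coordEps ε δ j

/-- The second privacy parameter of an instance. -/
def instanceDelta {d : ℕ} (δ : ℝ) : Instance d → ℝ
  | (_, none) => δ / 2
  | (j, some _) => coordDelta δ j

/-- The input of an instance. -/
def instanceBit {d : ℕ} (x : BinVec d) : Instance d → Bool
  | (j, none) => inClass j x
  | (j, some k) => x k && inClass j x

theorem instanceRandomizer_eq (n d : ℕ) (ε δ : ℝ) (x : BinVec d) (t : Instance d) :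
    instanceRandomizer n d ε δ x t =
      baseSumRandomizer n (instanceEps ε δ t) (instanceDelta δ t) 0.1 (instanceBit x t) := by
  obtain ⟨j, _ | k⟩ := t <;> rfl

/-- Tagging the messages of the instance `t`. -/
def tagHom {d : ℕ} (t : Instance d) : Multiset ℤˣ →+ Multiset (Message d) :=
  Multiset.mapAddMonoidHom fun y => (t, y)

theorem prod_instance {M : Type*} [CommMonoid M] {d : ℕ} (f : Instance d → M) :
    ∏ t, f t = (∏ j, f (j, none)) * ∏ jk : Level d × Fin d, f (jk.1, some jk.2) := by
  rw [Fintype.prod_prod_type, Fintype.prod_prod_type]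
  simp only [Fintype.prod_option, Finset.prod_mul_distrib]

theorem prod_allInstances {M : Type*} [CommMonoid M] {d : ℕ} (f : Instance d → M) :
    ((allInstances d).map f).prod = ∏ t, f t := by
  have h : ∀ L : List (Level d), ((L.flatMap fun j =>
      (j, none) :: (List.finRange d).map fun k => (j, some k)).map f).prod =
        (L.map fun j => f (j, none) * ∏ k, f (j, some k)).prod := by
    intro L
    induction L with
    | nil => rfl
    | cons j L ih =>
      rw [List.flatMap_cons, List.map_append, List.prod_append, ih, List.map_cons, List.prod_cons,
        List.map_cons, List.prod_cons, List.map_map]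
      rw [Fin.prod_univ_def]
      rfl
  rw [allInstances, h, ← Fin.prod_univ_def, Fintype.prod_prod_type]
  simp only [Fintype.prod_option]

theorem sparVecRandomizer_eq (n d : ℕ) (ε δ : ℝ) (x : BinVec d) :
    sparVecRandomizer n d ε δ x = ∏ t, mapHom (tagHom t) (baseSumRandomizer n (instanceEps ε δ t)
      (instanceDelta δ t) 0.1 (instanceBit x t)) := by
  rw [sparVecRandomizer, unionIndep_eq_prod, prod_allInstances]
  refine Finset.prod_congr rfl fun t _ => ?_
  rw [instanceRandomizer_eq]; rfl

/-! ### Parameters -/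

theorem two_le_logb {δ : ℝ} (hδ : 0 < δ) (hδ1 : δ ≤ 1 / 2) : 2 ≤ Real.logb 2 (2 / δ) := by
  rw [Real.le_logb_iff_rpow_le (by norm_num) (by positivity), le_div_iff₀ hδ]
  norm_num; linarith

theorem coordEps_pos {ε δ : ℝ} (hε : 0 < ε) (hδ : 0 < δ) (hδ1 : δ ≤ 1 / 2) (j : ℕ) :
    0 < coordEps ε δ j := by
  have := two_le_logb hδ hδ1
  rw [coordEps]; positivity

/-- This is the calibration of ε': the at most 2^j active coordinates of a class j vector have total
squared parameter at most a bound independent of j. -/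
theorem coordEps_sq {ε δ : ℝ} (hδ : 0 < δ) (hδ1 : δ ≤ 1 / 2) (j : ℕ) :
    2 ^ j * coordEps ε δ j ^ 2 = ε ^ 2 / (8 * Real.logb 2 (2 / δ)) := by
  have := two_le_logb hδ hδ1
  rw [coordEps, div_pow, mul_pow, Real.sq_sqrt (by positivity), pow_succ]
  field_simp
  ring

theorem instanceEps_pos {d : ℕ} {ε δ : ℝ} (hε : 0 < ε) (hδ : 0 < δ) (hδ1 : δ ≤ 1 / 2)
    (t : Instance d) : 0 < instanceEps ε δ t := by
  obtain ⟨j, _ | k⟩ := t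
  · exact half_pos hε
  · exact coordEps_pos hε hδ hδ1 j

theorem instanceEps_le {d : ℕ} {ε δ : ℝ} (hε1 : ε ≤ 10) (hδ : 0 < δ)
    (hδ1 : δ ≤ 1 / 2) (t : Instance d) : instanceEps ε δ t ≤ 5 := by
  obtain ⟨j, _ | k⟩ := t
  · change ε / 2 ≤ 5; linarith
  · have hL := two_le_logb hδ hδ1
    have h2 : (1 : ℝ) ≤ 2 ^ ((j : ℕ) + 1) := one_le_pow₀ (by norm_num)
    have h1 : 1 ≤ Real.sqrt (2 ^ ((j : ℕ) + 1) * Real.logb 2 (2 / δ)) := by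
      rw [Real.one_le_sqrt]; nlinarith
    change ε / (2 * Real.sqrt (2 ^ ((j : ℕ) + 1) * Real.logb 2 (2 / δ))) ≤ 5
    rw [div_le_iff₀ (by positivity)]
    nlinarith

theorem instanceDelta_pos {d : ℕ} {δ : ℝ} (hδ : 0 < δ) (t : Instance d) :
    0 < instanceDelta δ t := by
  obtain ⟨j, _ | k⟩ := t
  · exact half_pos hδ
  · change 0 < δ / _; positivity

theorem instanceDelta_le {d : ℕ} {δ : ℝ} (hδ1 : δ ≤ 1 / 2) (t : Instance d) :
    instanceDelta δ t ≤ 1 / 4 := by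
  obtain ⟨j, _ | k⟩ := t
  · change δ / 2 ≤ 1 / 4; linarith
  · change δ / 2 ^ ((j : ℕ) + 1) ≤ 1 / 4
    rw [div_le_iff₀ (by positivity), pow_succ]
    have h2 : (1 : ℝ) ≤ 2 ^ (j : ℕ) := one_le_pow₀ (by norm_num)
    linarith

theorem sparVecView_eq {n d : ℕ} (hn : 0 < n) {ε δ : ℝ} (hε : 0 < ε) (hδ : 0 < δ)
    (hδ1 : δ ≤ 1 / 2) (D : Fin n → BinVec d) :
    sparVecView n d ε δ D = ∏ t, mapHom (tagHom t) (baseView (instanceEps ε δ t)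
      (instanceDelta δ t) (∑ i, (instanceBit (D i) t).toNat)) := by
  rw [sparVecView, shuffledView_eq_prod]
  simp only [sparVecRandomizer_eq]
  rw [Finset.prod_comm]
  refine Finset.prod_congr rfl fun t _ => ?_
  rw [← map_prod, prod_baseSumRandomizer hn (instanceEps_pos hε hδ hδ1 t) (instanceDelta_pos hδ t)
    ((instanceDelta_le hδ1 t).trans (by norm_num))]

/-! ### Sparsity classes -/

theorem inClass_iff {d j : ℕ} {x : BinVec d} :
    inClass j x = true ↔ 2 ^ j < 2 * sparsity x ∧ sparsity x ≤ 2 ^ j := by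
  simp [inClass]

theorem inClass_unique {d i j : ℕ} {x : BinVec d} (hi : inClass i x = true)
    (hj : inClass j x = true) : i = j := by
  rw [inClass_iff] at hi hj
  by_contra h
  rcases Nat.lt_or_gt_of_ne h with h | h
  · have := Nat.pow_le_pow_right (n := 2) (by norm_num) (Nat.succ_le_of_lt h)
    rw [Nat.succ_eq_add_one, pow_succ] at this; omega
  · have := Nat.pow_le_pow_right (n := 2) (by norm_num) (Nat.succ_le_of_lt h)
    rw [Nat.succ_eq_add_one, pow_succ] at this; omega

theorem sum_inClass_le_one {d : ℕ} (x : BinVec d) :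
    ∑ j : Level d, (inClass (j : ℕ) x).toNat ≤ 1 := by
  classical
  by_cases h : ∃ j : Level d, inClass (j : ℕ) x = true
  · obtain ⟨j, hj⟩ := h
    rw [Finset.sum_eq_single j]
    · exact Bool.toNat_le _
    · intro i _ hij
      have : inClass (i : ℕ) x = false := by
        by_contra hc
        exact hij (Fin.ext (inClass_unique (by simpa using hc) hj))
      simp [this]
    · simp
  · push Not at h
    simp only [Bool.not_eq_true] at h
    simp [h]

theorem inClass_zero {d j : ℕ} : inClass j (fun _ => false : BinVec d) = false := by
  simp [inClass, sparsity]

/-- Every nonzero vector has a class. -/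
theorem exists_inClass {d : ℕ} {x : BinVec d} (hx : sparsity x ≠ 0) :
    ∃ j : Level d, inClass (j : ℕ) x = true := by
  have hd : sparsity x ≤ d := by
    calc sparsity x ≤ ∑ _k : Fin d, 1 := Finset.sum_le_sum fun k _ => Bool.toNat_le _
      _ = d := by simp
  -- The class is the rounded-up binary logarithm of the sparsity. Sparsity 1 is treated separately
  -- because there is no preceding power of two to compare with.
  refine ⟨⟨Nat.clog 2 (sparsity x), Nat.lt_succ_of_le (Nat.clog_mono_right 2 hd)⟩, ?_⟩
  rw [inClass_iff]
  refine ⟨?_, Nat.le_pow_clog (by norm_num) _⟩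
  change 2 ^ Nat.clog 2 (sparsity x) < _
  rcases Nat.lt_or_ge 1 (sparsity x) with h | h
  · have h1 := Nat.pow_pred_clog_lt_self (b := 2) (by norm_num) h
    have h2 : 0 < Nat.clog 2 (sparsity x) := Nat.clog_pos (by norm_num) h
    obtain ⟨c, hc⟩ := Nat.exists_eq_succ_of_ne_zero h2.ne'
    rw [hc] at h1 ⊢
    simp only [Nat.succ_eq_add_one, Nat.pred_eq_sub_one, Nat.add_sub_cancel] at h1
    rw [Nat.succ_eq_add_one, pow_succ]; omega
  · have : sparsity x = 1 := by omega
    simp [this]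

/-- Only the class of x contributes, and in class j at most 2^j coordinates are one. It is used both
for squared privacy parameters and for removed masses. -/
theorem sum_coord_le {d : ℕ} (x : BinVec d) {w : ℕ → ℝ} {W : ℝ} (hw : ∀ j, 0 ≤ w j)
    (hW : ∀ j, 2 ^ j * w j ≤ W) :
    ∑ jk : Level d × Fin d, ((x jk.2 && inClass (jk.1 : ℕ) x).toNat : ℝ) * w jk.1 ≤
      W * ∑ j : Level d, ((inClass (j : ℕ) x).toNat : ℝ) := by
  rw [Fintype.sum_prod_type, Finset.mul_sum]
  refine Finset.sum_le_sum fun j _ => ?_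
  simp only
  cases h : inClass (j : ℕ) x
  · simp
  · simp only [Bool.and_true, Bool.toNat_true, Nat.cast_one, mul_one, ← Finset.sum_mul]
    refine le_trans ?_ (hW j)
    refine mul_le_mul_of_nonneg_right ?_ (hw j)
    exact_mod_cast (inClass_iff.1 h).2

/-! ### Privacy -/

theorem ite_le_toNat_mul {b b' : Bool} {w : ℝ} (hw : 0 ≤ w) :
    (if b = b' then 0 else w) ≤ (b.toNat : ℝ) * w + (b'.toNat : ℝ) * w := by
  cases b <;> cases b' <;> simp [hw]

/-- When two bits differ, one of them is 1. A replacement is thus charged at most as the removal of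
the old vector plus the insertion of the new one. -/
theorem sum_ite_le {ι : Type*} (s : Finset ι) (b b' : ι → Bool) {w : ι → ℝ}
    (hw : ∀ i ∈ s, 0 ≤ w i) :
    ∑ i ∈ s, (if b i = b' i then 0 else w i) ≤
      ∑ i ∈ s, ((b i).toNat : ℝ) * w i + ∑ i ∈ s, ((b' i).toNat : ℝ) * w i := by
  rw [← Finset.sum_add_distrib]
  exact Finset.sum_le_sum fun i hi => ite_le_toNat_mul (hw i hi)

theorem ofReal_sum_ite {ι : Type*} (s : Finset ι) (b b' : ι → Bool) {w : ι → ℝ}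
    (hw : ∀ i ∈ s, 0 ≤ w i) :
    ∑ i ∈ s, (if b i = b' i then 0 else ENNReal.ofReal (w i)) =
      ENNReal.ofReal (∑ i ∈ s, if b i = b' i then 0 else w i) := by
  rw [ENNReal.ofReal_sum_of_nonneg]
  · refine Finset.sum_congr rfl fun i _ => ?_
    split_ifs <;> simp
  · intro i hi
    split_ifs
    · exact le_rfl
    · exact hw i hi

/-- Differential privacy of the view for the replacement of `D i` by `x`, where `N` bounds the
number of nonzero vectors among `D i` and `x`. -/
theorem sparVecView_replace {n d : ℕ} (hn : 0 < n) {ε δ N : ℝ} (hε : 0 < ε) (hε1 : ε ≤ 10)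
    (hδ : 0 < δ) (hδ1 : δ ≤ 1 / 2) (D : Fin n → BinVec d) (i : Fin n) (x : BinVec d) (hN : 1 ≤ N)
    (hNx : ∑ j : Level d, ((inClass (j : ℕ) (D i)).toNat : ℝ) +
      ∑ j : Level d, ((inClass (j : ℕ) x).toNat : ℝ) ≤ N) (S : Set (Multiset (Message d))) :
    (sparVecView n d ε δ D).toOuterMeasure S ≤ ENNReal.ofReal (Real.exp (N * ε)) *
      (sparVecView n d ε δ (Function.update D i x)).toOuterMeasure S +
        ENNReal.ofReal (N * δ) := by
  classical
  obtain ⟨α, c, hα, hc, hcT, hnum⟩ := exists_renyi_order hε hε1 hδ hδ1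
  set a : Instance d → ℝ := fun t =>
    if instanceBit (D i) t = instanceBit x t then 0 else instanceEps ε δ t with ha
  set η : Instance d → ℝ≥0∞ := fun t =>
    if instanceBit (D i) t = instanceBit x t then 0
    else ENNReal.ofReal (instanceDelta δ t / 20) with hη
  set P : (Fin n → BinVec d) → Instance d → PMF (Multiset (Message d)) := fun D t =>
    mapHom (tagHom t) (baseView (instanceEps ε δ t) (instanceDelta δ t)
      (∑ i, (instanceBit (D i) t).toNat)) with hP
  have hview : ∀ D, sparVecView n d ε δ D = (∏ j, P D (j, none)) *
      ∏ jk : Level d × Fin d, P D (jk.1, some jk.2) := fun D => by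
    rw [sparVecView_eq hn hε hδ hδ1, ← prod_instance]
  have hind : ∀ t, Indist (a t) (η t) (P D t) (P (Function.update D i x) t) := by
    intro t
    refine Indist.map ?_ (tagHom t)
    rw [← Finset.sum_erase_add _ _ (Finset.mem_univ i),
      ← Finset.sum_erase_add _ (fun i' => (instanceBit (Function.update D i x i') t).toNat)
        (Finset.mem_univ i), Function.update_self]
    have : ∑ i' ∈ Finset.univ.erase i, (instanceBit (Function.update D i x i') t).toNat =
        ∑ i' ∈ Finset.univ.erase i, (instanceBit (D i') t).toNat :=
      Finset.sum_congr rfl fun i' hi' => by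
        rw [Function.update_of_ne (Finset.ne_of_mem_erase hi')]
    rw [this]
    exact indist_baseView (instanceEps_pos hε hδ hδ1 t) (instanceEps_le hε1 hδ hδ1 t)
      (instanceDelta_pos hδ t) (instanceDelta_le hδ1 t) _ _ _
  have ha0 : ∀ t, 0 ≤ a t := by
    intro t
    simp only [ha]; split_ifs
    · exact le_rfl
    · exact (instanceEps_pos hε hδ hδ1 t).le
  -- total privacy parameters of the counts and of the coordinates
  have hcount : ∑ j : Level d, a (j, none) ≤ N * (ε / 2) := by
    refine (sum_ite_le _ _ _ fun j _ => (instanceEps_pos hε hδ hδ1 _).le).trans ?_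
    change ∑ j : Level d, ((inClass (j : ℕ) (D i)).toNat : ℝ) * (ε / 2) +
      ∑ j : Level d, ((inClass (j : ℕ) x).toNat : ℝ) * (ε / 2) ≤ _
    rw [← Finset.sum_mul, ← Finset.sum_mul, ← add_mul]
    gcongr
  have hcoord : ∑ jk : Level d × Fin d, a (jk.1, some jk.2) ^ 2 ≤
      N * (ε ^ 2 / (8 * Real.logb 2 (2 / δ))) := by
    have hL := two_le_logb hδ hδ1
    have e : ∀ jk : Level d × Fin d, a (jk.1, some jk.2) ^ 2 =
        if instanceBit (D i) (jk.1, some jk.2) = instanceBit x (jk.1, some jk.2) then 0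
        else coordEps ε δ jk.1 ^ 2 := by
      intro jk
      simp only [ha]; split_ifs
      · simp
      · rfl
    simp only [e]
    refine (sum_ite_le _ _ _ fun j _ => sq_nonneg _).trans ?_
    refine (add_le_add
      (sum_coord_le (D i) (fun j => sq_nonneg _) fun j => (coordEps_sq (ε := ε) hδ hδ1 j).le)
      (sum_coord_le x (fun j => sq_nonneg _)
        fun j => (coordEps_sq (ε := ε) hδ hδ1 j).le)).trans ?_
    rw [← mul_add, mul_comm]
    gcongr
  have hηcount : ∑ j : Level d, η (j, none) ≤ ENNReal.ofReal (N * (δ / 40)) := by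
    simp only [hη]
    rw [ofReal_sum_ite _ _ _ fun j _ => by
      have := instanceDelta_pos (d := d) hδ (j, none); positivity]
    refine ENNReal.ofReal_le_ofReal ?_
    refine (sum_ite_le _ _ _ fun j _ => by
      have := instanceDelta_pos (d := d) hδ (j, none); positivity).trans ?_
    change ∑ j : Level d, ((inClass (j : ℕ) (D i)).toNat : ℝ) * (δ / 2 / 20) +
      ∑ j : Level d, ((inClass (j : ℕ) x).toNat : ℝ) * (δ / 2 / 20) ≤ _
    rw [← Finset.sum_mul, ← Finset.sum_mul, ← add_mul, div_div]
    norm_num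
    gcongr
  have hηcoord : ∑ jk : Level d × Fin d, η (jk.1, some jk.2) ≤ ENNReal.ofReal (N * (δ / 40)) := by
    have hpos : ∀ jk ∈ (Finset.univ : Finset (Level d × Fin d)),
        0 ≤ instanceDelta δ (jk.1, some jk.2) / 20 := fun jk _ => by
      have := instanceDelta_pos (d := d) hδ (jk.1, some jk.2); positivity
    have hw : ∀ j : ℕ, 0 ≤ coordDelta δ j / 20 := fun j => by rw [coordDelta]; positivity
    have hW : ∀ j : ℕ, 2 ^ j * (coordDelta δ j / 20) ≤ δ / 40 := fun j => by
      rw [coordDelta, pow_succ]; apply le_of_eq; field_simp; norm_num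
    simp only [hη]
    rw [ofReal_sum_ite _ (fun jk : Level d × Fin d => instanceBit (D i) (jk.1, some jk.2))
      (fun jk => instanceBit x (jk.1, some jk.2)) hpos]
    refine ENNReal.ofReal_le_ofReal ?_
    refine (sum_ite_le _ _ _ hpos).trans ?_
    refine (add_le_add (sum_coord_le (D i) hw hW) (sum_coord_le x hw hW)).trans ?_
    rw [← mul_add, mul_comm]
    gcongr
  rw [hview, hview]
  have hcoordDP := fun S => prod_renyi Finset.univ hα hcT hc
    (P := fun jk : Level d × Fin d => P D (jk.1, some jk.2))
    (Q := fun jk : Level d × Fin d => P (Function.update D i x) (jk.1, some jk.2))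
    (fun jk _ => ha0 (jk.1, some jk.2)) (fun jk _ => hind (jk.1, some jk.2)) S
    (Real.exp (N * (ε / 2))) (Real.exp_pos _)
  have h := prod_mul_dp Finset.univ (fun j _ => hind (j, none))
    (fun S => by rw [← add_assoc]; exact hcoordDP S) S
  refine h.trans ?_
  refine add_le_add (mul_le_mul_left ?_ _) ?_
  · rw [← ENNReal.ofReal_mul (Real.exp_pos _).le, ← Real.exp_add]
    refine ENNReal.ofReal_le_ofReal (Real.exp_le_exp.2 ?_)
    linarith
  · have hren : Real.exp (α * (α + 1) / 2 * ∑ jk : Level d × Fin d, a (jk.1, some jk.2) ^ 2) * c *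
        Real.exp (N * (ε / 2)) ^ (-α) ≤ 0.9 * δ := by
      refine le_trans ?_ (hnum N hN)
      have : α * (α + 1) / 2 * ∑ jk : Level d × Fin d, a (jk.1, some jk.2) ^ 2 ≤
          N * (α * (α + 1) / 2 * (ε ^ 2 / (8 * Real.logb 2 (2 / δ)))) := by
        rw [mul_left_comm]
        gcongr
      gcongr
    -- The total is 0.9δ + Nδ/20, which is at most Nδ because N ≥ 1.
    calc _ ≤ ENNReal.ofReal (N * (δ / 40)) +
          (ENNReal.ofReal (0.9 * δ) + ENNReal.ofReal (N * (δ / 40))) := by gcongr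
      _ = ENNReal.ofReal (N * (δ / 40) + (0.9 * δ + N * (δ / 40))) := by
          rw [← ENNReal.ofReal_add (by positivity) (by positivity),
            ← ENNReal.ofReal_add (by positivity) (by positivity)]
      _ ≤ _ := ENNReal.ofReal_le_ofReal (by nlinarith)

theorem sum_inClass_cast_le_one {d : ℕ} (x : BinVec d) :
    ∑ j : Level d, ((inClass (j : ℕ) x).toNat : ℝ) ≤ 1 := by
  exact_mod_cast sum_inClass_le_one x

theorem isDP_remove {n d : ℕ} (hn : 0 < n) {ε δ : ℝ} (hε : 0 < ε) (hε1 : ε ≤ 10)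
    (hδ : 0 < δ) (hδ1 : δ ≤ 1 / 2) : IsDP RemoveNeighbour (sparVecView n d ε δ) ε δ := by
  rintro D D' ⟨i, rfl | rfl⟩ S
  · have := sparVecView_replace (N := 1) hn hε hε1 hδ hδ1 D i (fun _ => false) le_rfl
      (by simpa [inClass_zero] using sum_inClass_cast_le_one (D i)) S
    simpa only [one_mul] using this
  · have := sparVecView_replace (N := 1) hn hε hε1 hδ hδ1
      (Function.update D' i fun _ => false) i (D' i) le_rfl
      (by simpa [inClass_zero] using sum_inClass_cast_le_one (D' i)) S
    simpa only [one_mul, Function.update_idem, Function.update_eq_self] using this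

theorem isDP_replace {n d : ℕ} (hn : 0 < n) {ε δ : ℝ} (hε : 0 < ε) (hε1 : ε ≤ 10)
    (hδ : 0 < δ) (hδ1 : δ ≤ 1 / 2) :
    IsDP ReplaceNeighbour (sparVecView n d ε δ) (2 * ε) (2 * δ) := by
  rintro D D' ⟨i, x, rfl⟩ S
  exact sparVecView_replace (N := 2) hn hε hε1 hδ hδ1 D i x one_le_two
    (by linarith [sum_inClass_cast_le_one (D i), sum_inClass_cast_le_one x]) S

/-! ### The noise of the analyzer -/

theorem baseSumAnalyzer_messagesHom (u v : ℕ) :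
    baseSumAnalyzer (messagesHom (u, v)) = (u : ℤ) - v := by
  simp [baseSumAnalyzer, messagesHom_apply, Multiset.map_replicate, sub_eq_add_neg]

/-- Both variables are nonnegative, so a difference exceeding x forces one of them to exceed x.
Their marginals are the images under the coordinate projections. -/
theorem two_geom_tail {p x : ℝ} (hp : 0 < p) (hp1 : p < 1) (hx : 0 ≤ x) :
    (mapHom (AddMonoidHom.inl ℕ ℕ) (negBin 1 p) *
      mapHom (AddMonoidHom.inr ℕ ℕ) (negBin 1 p)).toOuterMeasure
        {w | x < |((w.1 : ℝ) - w.2)|} ≤ ENNReal.ofReal (2 * p ^ x) := by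
  set Q := mapHom (AddMonoidHom.inl ℕ ℕ) (negBin 1 p) *
      mapHom (AddMonoidHom.inr ℕ ℕ) (negBin 1 p) with hQ
  have hfst : mapHom (AddMonoidHom.fst ℕ ℕ) Q = negBin 1 p := by
    rw [hQ, map_mul, mapHom_mapHom, mapHom_mapHom, AddMonoidHom.fst_comp_inl,
      AddMonoidHom.fst_comp_inr, mapHom_zero, mul_one]
    exact PMF.map_id _
  have hsnd : mapHom (AddMonoidHom.snd ℕ ℕ) Q = negBin 1 p := by
    rw [hQ, map_mul, mapHom_mapHom, mapHom_mapHom, AddMonoidHom.snd_comp_inl,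
      AddMonoidHom.snd_comp_inr, mapHom_zero, one_mul]
    exact PMF.map_id _
  have hsub : {w : ℕ × ℕ | x < |((w.1 : ℝ) - w.2)|} ⊆
      (AddMonoidHom.fst ℕ ℕ ⁻¹' {k | x < (k : ℝ)}) ∪
        (AddMonoidHom.snd ℕ ℕ ⁻¹' {k | x < (k : ℝ)}) := by
    rintro ⟨a, b⟩ h
    have h' : x < |(a : ℝ) - b| := h
    have ha : (0 : ℝ) ≤ a := Nat.cast_nonneg a
    have hb : (0 : ℝ) ≤ b := Nat.cast_nonneg b
    rcases lt_abs.1 h' with h1 | h1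
    · left; change x < (a : ℝ); linarith
    · right; change x < (b : ℝ); linarith
  have hpx : 0 ≤ p ^ x := Real.rpow_nonneg hp.le x
  calc _ ≤ _ := MeasureTheory.measure_mono hsub
    _ ≤ _ := MeasureTheory.measure_union_le _ _
    _ ≤ ENNReal.ofReal (p ^ x) + ENNReal.ofReal (p ^ x) := by
        rw [← toOuterMeasure_mapHom, ← toOuterMeasure_mapHom, hfst, hsnd]
        gcongr <;> exact negBin_one_tail hp hp1 hx
    _ = _ := by rw [← ENNReal.ofReal_add hpx hpx, two_mul]

/-- Conditionally on c, the pairs cancel in the sum and the error is the difference of the two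
geometric variables. The bound is uniform in c, so it survives averaging. -/
theorem baseView_tail {ε δ x : ℝ} (hε : 0 < ε) (hx : 0 ≤ x) (B : ℕ) :
    (baseView ε δ B).toOuterMeasure {s | x < |((baseSumAnalyzer s : ℝ) - B)|} ≤
      ENNReal.ofReal (2 * Real.exp (-(0.9 * ε * x))) := by
  rw [baseView, toOuterMeasure_mapHom, baseNoise, pairNoise_eq_bind, conv_def, PMF.pure_bind,
    PMF.toOuterMeasure_map_apply, PMF.toOuterMeasure_bind_apply]
  set p := Real.exp (-((1 - 0.1) * ε)) with hp
  set E := ENNReal.ofReal (2 * Real.exp (-(0.9 * ε * x))) with hE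
  refine le_trans (ENNReal.tsum_le_tsum fun c => mul_le_mul_right (b := _) (c := E) ?_ _) ?_
  · rw [shiftedGeom, pure_mul_eq_map, PMF.toOuterMeasure_map_apply]
    have e : p ^ x = Real.exp (-(0.9 * ε * x)) := by
      rw [hp, ← Real.exp_mul]; congr 1; ring
    rw [hE, ← e]
    refine le_trans (MeasureTheory.measure_mono ?_)
      (two_geom_tail (Real.exp_pos _) (exp_neg_lt_one (by linarith)) hx)
    rintro ⟨a, b⟩ h
    change x < |((baseSumAnalyzer (messagesHom ((B, 0) + ((c, c) + (a, b)))) : ℝ) - B)| at h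
    rw [Prod.mk_add_mk, Prod.mk_add_mk, baseSumAnalyzer_messagesHom] at h
    push_cast at h
    change x < |(a : ℝ) - b|
    convert h using 2
    ring
  · rw [ENNReal.tsum_mul_right, PMF.tsum_coe, one_mul]

/-! ### Marginal law of one instance, and simultaneous accuracy. -/

/-- Selecting the messages of one instance is an additive homomorphism. -/
def selectHom {d : ℕ} (t : Instance d) : Multiset (Message d) →+ Multiset ℤˣ where
  toFun R := instanceMessages R t
  map_zero' := by simp [instanceMessages]
  map_add' s t := by simp [instanceMessages]

theorem selectHom_comp_tagHom_self {d : ℕ} (t : Instance d) :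
    (selectHom t).comp (tagHom t) = AddMonoidHom.id _ := by
  refine AddMonoidHom.ext fun s => ?_
  change Multiset.map Prod.snd (Multiset.filter _ (Multiset.map _ s)) = s
  rw [Multiset.filter_map, Multiset.map_map, Multiset.filter_eq_self.2 (by simp)]
  exact Multiset.map_id _

theorem selectHom_comp_tagHom_of_ne {d : ℕ} {t t' : Instance d} (h : t' ≠ t) :
    (selectHom t).comp (tagHom t') = 0 := by
  refine AddMonoidHom.ext fun s => ?_
  change Multiset.map Prod.snd (Multiset.filter _ (Multiset.map _ s)) = 0
  rw [Multiset.filter_map, Multiset.map_map, Multiset.filter_eq_nil.2 (by simp [h])]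
  rfl

/-- Selection of t inverts the tagging by t and sends every other factor to the unit, so exactly one
factor of the product survives. -/
theorem mapHom_selectHom_sparVecView {n d : ℕ} (hn : 0 < n) {ε δ : ℝ} (hε : 0 < ε) (hδ : 0 < δ)
    (hδ1 : δ ≤ 1 / 2) (D : Fin n → BinVec d) (t : Instance d) :
    mapHom (selectHom t) (sparVecView n d ε δ D) = baseView (instanceEps ε δ t)
      (instanceDelta δ t) (∑ i, (instanceBit (D i) t).toNat) := by
  classical
  rw [sparVecView_eq hn hε hδ hδ1, map_prod, Finset.prod_eq_single t]
  · rw [mapHom_mapHom, selectHom_comp_tagHom_self]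
    exact PMF.map_id _
  · intro t' _ ht'
    rw [mapHom_mapHom, selectHom_comp_tagHom_of_ne ht', mapHom_zero]
  · simp

/-- All noisy sums are simultaneously accurate with high probability. -/
theorem sparVecView_accurate {n d : ℕ} (hn : 0 < n) {ε δ β : ℝ} (hε : 0 < ε) (hδ : 0 < δ)
    (hδ1 : δ ≤ 1 / 2) (D : Fin n → BinVec d) {x : Instance d → ℝ} (hx : ∀ t, 0 ≤ x t)
    (hβ : ∑ t, 2 * Real.exp (-(0.9 * instanceEps ε δ t * x t)) ≤ β) :
    ENNReal.ofReal (1 - β) ≤ (sparVecView n d ε δ D).toOuterMeasure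
      {R | ∀ t, |(baseSumAnalyzer (instanceMessages R t) : ℝ) -
        (∑ i, (instanceBit (D i) t).toNat : ℕ)| ≤ x t} := by
  have hβ0 : 0 ≤ β := le_trans (Finset.sum_nonneg fun t _ => by positivity) hβ
  set P := sparVecView n d ε δ D with hP
  set G := {R | ∀ t, |(baseSumAnalyzer (instanceMessages R t) : ℝ) -
        (∑ i, (instanceBit (D i) t).toNat : ℕ)| ≤ x t} with hG
  set F : Instance d → Set (Multiset (Message d)) := fun t =>
    {R | x t < |(baseSumAnalyzer (instanceMessages R t) : ℝ) -
      (∑ i, (instanceBit (D i) t).toNat : ℕ)|} with hF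
  have hcover : (Set.univ : Set (Multiset (Message d))) ⊆ G ∪ ⋃ t, F t := by
    intro R _
    by_cases h : R ∈ G
    · exact Or.inl h
    · right
      rw [hG, Set.mem_ofPred_eq] at h
      push Not at h
      exact Set.mem_iUnion.2 h
  have hone : P.toOuterMeasure Set.univ = 1 := by
    rw [PMF.toOuterMeasure_apply, Set.indicator_univ, P.tsum_coe]
  have hbad : P.toOuterMeasure (⋃ t, F t) ≤ ENNReal.ofReal β := by
    refine (MeasureTheory.measure_iUnion_fintype_le _ _).trans ?_
    refine le_trans (Finset.sum_le_sum fun t _ => ?_) (le_trans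
      (ENNReal.ofReal_sum_of_nonneg fun t _ => ?_).ge (ENNReal.ofReal_le_ofReal hβ))
    · have := baseView_tail (δ := instanceDelta δ t) (instanceEps_pos hε hδ hδ1 t) (hx t)
        (∑ i, (instanceBit (D i) t).toNat)
      rw [← mapHom_selectHom_sparVecView hn hε hδ hδ1 D t, toOuterMeasure_mapHom] at this
      exact this
    · positivity
  have h1 : 1 ≤ P.toOuterMeasure G + ENNReal.ofReal β := by
    calc 1 = P.toOuterMeasure Set.univ := hone.symm
      _ ≤ _ := MeasureTheory.measure_mono hcover
      _ ≤ _ := MeasureTheory.measure_union_le _ _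
      _ ≤ _ := by gcongr
  rw [ENNReal.ofReal_sub _ hβ0, ENNReal.ofReal_one]
  exact tsub_le_iff_right.2 h1

/-! ### Accuracy -/

/-- The last hit overwrites earlier ones, so the induction peels off the end of the list. As the
list increases, the last hit is also the largest. -/
theorem foldl_select {m : ℕ} (p : Fin m → Prop) [DecidablePred p] (L : List (Fin m))
    (hL : L.Pairwise (· < ·)) :
    (∀ j ∈ L, p j → 2 ^ (j : ℕ) ≤ L.foldl (fun τ j => if p j then 2 ^ (j : ℕ) else τ) 0) ∧
      (L.foldl (fun τ j => if p j then 2 ^ (j : ℕ) else τ) 0 = 0 ∨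
        ∃ j, p j ∧ L.foldl (fun τ j => if p j then 2 ^ (j : ℕ) else τ) 0 = 2 ^ (j : ℕ)) := by
  induction L using List.reverseRecOn with
  | nil => simp
  | append_singleton L a ih =>
    rw [List.pairwise_append] at hL
    obtain ⟨ih1, ih2⟩ := ih hL.1
    rw [List.foldl_append, List.foldl_cons, List.foldl_nil]
    by_cases ha : p a
    · rw [if_pos ha]
      refine ⟨fun j hj _ => ?_, Or.inr ⟨a, ha, rfl⟩⟩
      rcases List.mem_append.1 hj with h | h
      · exact Nat.pow_le_pow_right (by norm_num) (hL.2.2 j h a (by simp)).le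
      · rw [List.mem_singleton.1 h]
    · rw [if_neg ha]
      refine ⟨fun j hj hp => ?_, ih2⟩
      rcases List.mem_append.1 hj with h | h
      · exact ih1 j h hp
      · rw [List.mem_singleton.1 h] at hp; exact absurd hp ha

theorem le_selectTau {d : ℕ} {ε β : ℝ} {R : Multiset (Message d)} {j : Level d}
    (h : countThreshold d ε β < (noisyCount R j : ℝ)) : 2 ^ (j : ℕ) ≤ selectTau ε β R := by
  classical
  have := (foldl_select (fun j : Level d => countThreshold d ε β < (noisyCount R j : ℝ)) _
    (List.pairwise_lt_finRange _)).1 j (List.mem_finRange j) h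
  unfold selectTau
  -- The two sides differ only in their decidability instances.
  convert this

theorem exists_of_le_selectTau {d : ℕ} {ε β : ℝ} {R : Multiset (Message d)} {j : ℕ}
    (h : 2 ^ j ≤ selectTau ε β R) :
    ∃ j' : Level d, countThreshold d ε β < (noisyCount R j' : ℝ) ∧ 2 ^ j ≤ 2 ^ (j' : ℕ) := by
  classical
  have h2 := (foldl_select (fun j : Level d => countThreshold d ε β < (noisyCount R j : ℝ)) _
    (List.pairwise_lt_finRange _)).2
  unfold selectTau at h
  rcases h2 with h2 | ⟨j', hj', h2⟩
  · have : 2 ^ j ≤ 0 := by rw [← h2]; convert h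
    have h3 : 0 < 2 ^ j := by positivity
    omega
  · exact ⟨j', hj', by rw [← h2]; convert h⟩

theorem sparsity_le_maxL2_sq {n d : ℕ} (D : Fin n → BinVec d) (i : Fin n) :
    (sparsity (D i) : ℝ) ≤ maxL2 D ^ 2 := by
  have h1 : ‖toEuclidean (D i)‖ ≤ maxL2 D :=
    le_ciSup (f := fun i => ‖toEuclidean (D i)‖) (Set.finite_range _).bddAbove i
  have h2 : ‖toEuclidean (D i)‖ ^ 2 = (sparsity (D i) : ℝ) := by
    rw [EuclideanSpace.real_norm_sq_eq, sparsity]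
    push_cast
    refine Finset.sum_congr rfl fun k _ => ?_
    change ((D i k).toNat : ℝ) ^ 2 = _
    cases D i k <;> simp
  rw [← h2]
  gcongr

theorem maxL2_nonneg {n d : ℕ} (D : Fin n → BinVec d) : 0 ≤ maxL2 D :=
  Real.iSup_nonneg fun _ => norm_nonneg _

theorem pow_lt_of_count_pos {n d j : ℕ} (D : Fin n → BinVec d)
    (h : 0 < ∑ i, (inClass j (D i)).toNat) : (2 : ℝ) ^ j < 2 * maxL2 D ^ 2 := by
  obtain ⟨i, -, hi⟩ := Finset.exists_ne_zero_of_sum_ne_zero h.ne'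
  have hc : inClass j (D i) = true := by
    by_contra hc
    simp [hc] at hi
  have h1 : (2 : ℝ) ^ j < 2 * sparsity (D i) := by exact_mod_cast (inClass_iff.1 hc).1
  linarith [sparsity_le_maxL2_sq D i]

theorem toNat_eq_sum_level {d : ℕ} (x : BinVec d) (k : Fin d) :
    (x k).toNat = ∑ j : Level d, (x k && inClass (j : ℕ) x).toNat := by
  classical
  cases h : x k
  · simp
  · have hs : sparsity x ≠ 0 := by
      intro h0
      have := (Finset.sum_eq_zero_iff.1 h0) k (Finset.mem_univ k)
      simp [h] at this
    obtain ⟨j, hj⟩ := exists_inClass hs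
    simp only [Bool.true_and]
    refine le_antisymm ?_ (sum_inClass_le_one x)
    refine le_trans ?_ (Finset.single_le_sum (f := fun j : Level d => (inClass (j : ℕ) x).toNat)
      (fun _ _ => Nat.zero_le _) (Finset.mem_univ j))
    simp [hj]

/-- In a geometric sum with ratio √2 the constant 4 is preserved by the induction, because 4 + √2 ≤
4√2. -/
theorem sum_sqrt_pow_le (m : ℕ) :
    ∑ j ∈ Finset.range (m + 1), Real.sqrt (2 ^ j) ≤ 4 * Real.sqrt (2 ^ m) := by
  induction m with
  | zero => simp
  | succ m ih =>
    rw [Finset.sum_range_succ]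
    have h : Real.sqrt (2 ^ (m + 1)) = Real.sqrt (2 ^ m) * Real.sqrt 2 := by
      rw [pow_succ, Real.sqrt_mul (by positivity)]
    have h2 : (4 : ℝ) / 3 ≤ Real.sqrt 2 := Real.le_sqrt_of_sq_le (by norm_num)
    have h3 : 0 ≤ Real.sqrt (2 ^ m) := Real.sqrt_nonneg _
    nlinarith

/-- The admissible indices form an initial segment, so the sum is dominated by its last admissible
term, which is at most √A. -/
theorem sum_sqrt_pow_filter_le {A : ℝ} (m : ℕ) :
    ∑ j ∈ Finset.range m, (if (2 : ℝ) ^ j < A then Real.sqrt (2 ^ j) else 0) ≤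
      4 * Real.sqrt A := by
  induction m with
  | zero => simp
  | succ m ih =>
    by_cases h : (2 : ℝ) ^ m < A
    · calc _ ≤ ∑ j ∈ Finset.range (m + 1), Real.sqrt (2 ^ j) := by
            refine Finset.sum_le_sum fun j _ => ?_
            split_ifs
            · exact le_rfl
            · exact Real.sqrt_nonneg _
        _ ≤ 4 * Real.sqrt (2 ^ m) := sum_sqrt_pow_le m
        _ ≤ _ := by gcongr
    · rw [Finset.sum_range_succ, if_neg h, add_zero]
      exact ih

/-- Error of the analyzer when all noisy sums are accurate. -/
theorem analyzer_error_le {n d : ℕ} {ε β θ K : ℝ} (hθ : 0 ≤ θ) (hK : 0 ≤ K)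
    (hθe : countThreshold d ε β = θ) (D : Fin n → BinVec d) {R : Multiset (Message d)}
    (hcount : ∀ j : Level d,
      |(noisyCount R j : ℝ) - (∑ i, (inClass (j : ℕ) (D i)).toNat : ℕ)| ≤ θ)
    (hsum : ∀ (j : Level d) (k : Fin d),
      |(noisySum R j k : ℝ) - (∑ i, (D i k && inClass (j : ℕ) (D i)).toNat : ℕ)| ≤
        K * Real.sqrt (2 ^ (j : ℕ))) (k : Fin d) :
    |(sparVecAnalyzer ε β R k : ℝ) - ∑ i, ((D i k).toNat : ℝ)| ≤
      6 * (K + 2 * θ) * maxL2 D := by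
  classical
  have htrue : ∑ i, ((D i k).toNat : ℝ) =
      ∑ j : Level d, ((∑ i, (D i k && inClass (j : ℕ) (D i)).toNat : ℕ) : ℝ) := by
    have : ∑ i, (D i k).toNat = ∑ j : Level d, ∑ i, (D i k && inClass (j : ℕ) (D i)).toNat := by
      rw [Finset.sum_comm]
      exact Finset.sum_congr rfl fun i _ => toNat_eq_sum_level (D i) k
    exact_mod_cast this
  have hle : ∀ j : Level d, (∑ i, (D i k && inClass (j : ℕ) (D i)).toNat) ≤
      ∑ i, (inClass (j : ℕ) (D i)).toNat := fun j =>
    Finset.sum_le_sum fun i _ => by cases D i k <;> simp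
  have hterm : ∀ j : Level d,
      |((if 2 ^ (j : ℕ) ≤ selectTau ε β R then noisySum R j k else 0 : ℤ) : ℝ) -
        (∑ i, (D i k && inClass (j : ℕ) (D i)).toNat : ℕ)| ≤
      (K + 2 * θ) * if (2 : ℝ) ^ (j : ℕ) < 2 * maxL2 D ^ 2 then Real.sqrt (2 ^ (j : ℕ)) else 0 := by
    intro j
    have hsq : 1 ≤ Real.sqrt (2 ^ (j : ℕ)) := by
      rw [Real.one_le_sqrt]; exact one_le_pow₀ (by norm_num)
    by_cases hτ : 2 ^ (j : ℕ) ≤ selectTau ε β R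
    · rw [if_pos hτ]
      -- A class j' at or above j passed the threshold. Its noise is at most θ, so it contains a
      -- vector, and this vector bounds 2^j by 2·Max².
      obtain ⟨j', hj', hjj'⟩ := exists_of_le_selectTau hτ
      have hpos : 0 < ∑ i, (inClass (j' : ℕ) (D i)).toNat := by
        have h1 := (abs_le.1 (hcount j')).2
        rw [hθe] at hj'
        have : (0 : ℝ) < (∑ i, (inClass (j' : ℕ) (D i)).toNat : ℕ) := by linarith
        exact_mod_cast this
      have hlt : (2 : ℝ) ^ (j : ℕ) < 2 * maxL2 D ^ 2 :=
        lt_of_le_of_lt (by exact_mod_cast hjj') (pow_lt_of_count_pos D hpos)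
      rw [if_pos hlt]
      refine (hsum j k).trans ?_
      gcongr
      linarith
    · rw [if_neg hτ]
      -- A dropped class failed the threshold, so its true count, and hence the loss in any
      -- coordinate, is at most 2θ. The factor √(2^j) ≥ 1 is inserted so that nonempty dropped
      -- classes join the same geometric sum; empty ones lose nothing.
      have hc : (noisyCount R j : ℝ) ≤ θ := by
        by_contra hc
        rw [← hθe] at hc
        exact hτ (le_selectTau (not_le.1 hc))
      have hB : ((∑ i, (inClass (j : ℕ) (D i)).toNat : ℕ) : ℝ) ≤ 2 * θ := by
        have := (abs_le.1 (hcount j)).1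
        linarith
      have hB' : ((∑ i, (D i k && inClass (j : ℕ) (D i)).toNat : ℕ) : ℝ) ≤ 2 * θ :=
        le_trans (by exact_mod_cast hle j) hB
      rw [Int.cast_zero, zero_sub, abs_neg, Nat.abs_cast]
      split_ifs with hlt
      · nlinarith
      · have : ∑ i, (inClass (j : ℕ) (D i)).toNat = 0 := by
          by_contra h0
          exact hlt (pow_lt_of_count_pos D (Nat.pos_of_ne_zero h0))
        have h0 := hle j
        rw [this] at h0
        rw [Nat.le_zero.1 h0, Nat.cast_zero, mul_zero]
  have hmax := maxL2_nonneg D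
  rw [htrue, sparVecAnalyzer, Int.cast_sum, ← Finset.sum_sub_distrib]
  calc _ ≤ _ := Finset.abs_sum_le_sum_abs _ _
    _ ≤ ∑ j : Level d, (K + 2 * θ) *
          if (2 : ℝ) ^ (j : ℕ) < 2 * maxL2 D ^ 2 then Real.sqrt (2 ^ (j : ℕ)) else 0 :=
        Finset.sum_le_sum fun j _ => hterm j
    _ = (K + 2 * θ) * ∑ j ∈ Finset.range (Nat.clog 2 d + 1),
          if (2 : ℝ) ^ j < 2 * maxL2 D ^ 2 then Real.sqrt (2 ^ j) else 0 := by
        rw [← Finset.mul_sum, Fin.sum_univ_eq_sum_range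
          (fun j => if (2 : ℝ) ^ j < 2 * maxL2 D ^ 2 then Real.sqrt (2 ^ j) else 0)]
    _ ≤ (K + 2 * θ) * (4 * Real.sqrt (2 * maxL2 D ^ 2)) := by
        gcongr
        exact sum_sqrt_pow_filter_le _
    _ = (K + 2 * θ) * (4 * (Real.sqrt 2 * maxL2 D)) := by
        rw [Real.sqrt_mul (by norm_num), Real.sqrt_sq hmax]
    _ ≤ (K + 2 * θ) * (4 * (1.5 * maxL2 D)) := by
        gcongr
        exact Real.sqrt_le_iff.2 ⟨by norm_num, by norm_num⟩
    _ = _ := by ring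

/-! ### Failure probabilities and the final accuracy bound. -/

theorem clog_add_one_le {d : ℕ} (hd : 2 ≤ d) : Nat.clog 2 d + 1 ≤ d := by
  have h : d ≤ 2 ^ (d - 1) := by
    have := Nat.lt_two_pow_self (n := d - 1); omega
  have := Nat.clog_le_of_le_pow h
  omega

theorem eq_exp_logb {y : ℝ} (hy : 0 < y) : y = Real.exp (Real.logb 2 y * Real.log 2) := by
  rw [Real.logb, div_mul_cancel₀ _ (Real.log_pos (by norm_num)).ne', Real.exp_log hy]

/-- As y = e^{ln 2 · log y} with log y ≥ 2, the exponent is at most 2(ln 2 - 1.17) ≤ -ln 2. The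
factor 1.17 is 0.9·1.3, from the noise rate and the threshold. -/
theorem count_failure_le {y β : ℝ} (hβ : 0 ≤ β) (hy : 4 ≤ y) :
    y * β * Real.exp (-(1.17 * Real.logb 2 y)) ≤ β / 2 := by
  have hl : 2 ≤ Real.logb 2 y := by
    rw [Real.le_logb_iff_rpow_le (by norm_num) (by linarith)]; norm_num; exact hy
  have h2 := Real.log_two_lt_d9
  have h : y * Real.exp (-(1.17 * Real.logb 2 y)) ≤ 1 / 2 := by
    have e : (1 / 2 : ℝ) = Real.exp (-Real.log 2) := by
      rw [Real.exp_neg, Real.exp_log (by norm_num), one_div]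
    calc _ = Real.exp (Real.logb 2 y * Real.log 2) * Real.exp (-(1.17 * Real.logb 2 y)) := by
          rw [← eq_exp_logb (by linarith)]
      _ ≤ 1 / 2 := by
          rw [← Real.exp_add, e, Real.exp_le_exp]
          nlinarith
  calc _ = β * (y * Real.exp (-(1.17 * Real.logb 2 y))) := by ring
    _ ≤ β * (1 / 2) := by gcongr
    _ = _ := by ring

theorem coord_failure_le {D β : ℝ} (hβ : 0 < β) (hβ1 : β < 1) (hD : 2 ≤ D) :
    D * D * (2 * Real.exp (-(9 * Real.logb 2 (D / β)))) ≤ β / 2 := by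
  have hl : 0 ≤ Real.logb 2 (D / β) :=
    Real.logb_nonneg (by norm_num) (by rw [le_div_iff₀ hβ]; linarith)
  have h2 := Real.log_two_lt_d9
  have h : Real.exp (-(9 * Real.logb 2 (D / β))) ≤ (β / D) ^ 4 := by
    have e : β / D = Real.exp (-(Real.logb 2 (D / β) * Real.log 2)) := by
      rw [Real.exp_neg, ← eq_exp_logb (by positivity), inv_div]
    rw [e, ← Real.exp_nat_mul, Real.exp_le_exp]
    push_cast
    nlinarith
  calc D * D * (2 * Real.exp (-(9 * Real.logb 2 (D / β))))
      ≤ D * D * (2 * (β / D) ^ 4) := by gcongr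
    _ = β * (2 * β ^ 3 / D ^ 2) := by field_simp
    _ ≤ β * (2 * 1 ^ 3 / 2 ^ 2) := by gcongr
    _ = _ := by ring

/-- The accuracy of `SparVecSumDP`. -/
theorem sparVecSumDP_accuracy {n d : ℕ} (hn : 0 < n) (hd : 2 ≤ d) {ε δ β : ℝ} (hε : 0 < ε)
    (hδ : 0 < δ) (hδ1 : δ ≤ 1 / 2) (hβ : 0 < β) (hβ1 : β < 1) {C : ℝ} (hC : 400 ≤ C)
    (D : Fin n → BinVec d) :
    ENNReal.ofReal (1 - β) ≤ (sparVecSumDP n d ε δ β D).toOuterMeasure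
      {y | ∀ k : Fin d, |(y k : ℝ) - ∑ i, ((D i k).toNat : ℝ)| ≤
        C * ((maxL2 D * Real.sqrt (Real.logb 2 (1 / δ)) + Real.logb 2 (Real.logb 2 d)) *
          Real.logb 2 (d / β) / ε)} := by
  have hd' : (2 : ℝ) ≤ d := by exact_mod_cast hd
  have hm : (Nat.clog 2 d : ℝ) + 1 ≤ d := by exact_mod_cast clog_add_one_le hd
  have hm1 : (1 : ℝ) ≤ Nat.clog 2 d := by
    exact_mod_cast Nat.clog_pos (by norm_num) (by omega : 1 < d)
  set l := Real.logb 2 (d / β) with hl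
  set y := 2 * ((Nat.clog 2 d : ℝ) + 1) / β with hy
  have hy4 : 4 ≤ y := by rw [hy, le_div_iff₀ hβ]; nlinarith
  have hly : 2 ≤ Real.logb 2 y := by
    rw [Real.le_logb_iff_rpow_le (by norm_num) (by linarith)]; norm_num; exact hy4
  have hl1 : 1 ≤ l := by
    rw [hl, Real.le_logb_iff_rpow_le (by norm_num) (by positivity), le_div_iff₀ hβ]
    norm_num; nlinarith
  have hlyl : Real.logb 2 y ≤ 2 * l := by
    have : Real.logb 2 ((d / β) ^ 2) = 2 * l := by
      rw [Real.logb_pow, hl]; norm_num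
    rw [← this]
    refine Real.logb_le_logb_of_le (by norm_num) (by linarith) ?_
    rw [hy, div_pow, div_le_div_iff₀ hβ (by positivity)]
    have h1 : 2 * ((Nat.clog 2 d : ℝ) + 1) ≤ (d : ℝ) ^ 2 := by nlinarith
    have h2 : β ^ 2 ≤ β := by nlinarith
    exact mul_le_mul h1 h2 (by positivity) (by positivity)
  set lam := Real.logb 2 (1 / δ) with hlam
  have hlam1 : 1 ≤ lam := by
    rw [hlam, Real.le_logb_iff_rpow_le (by norm_num) (by positivity), le_div_iff₀ hδ]
    norm_num; linarith
  have hL : Real.logb 2 (2 / δ) = 1 + lam := by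
    rw [hlam, div_eq_mul_one_div, Real.logb_mul (by norm_num) (by positivity)]
    simp
  set θ := countThreshold d ε β with hθ
  have hθeq : θ = 1.3 * (2 / ε) * Real.logb 2 y := rfl
  have hθ0 : 0 ≤ θ := by rw [hθeq]; positivity
  set K := 20 * l * Real.sqrt (2 * Real.logb 2 (2 / δ)) / ε with hK
  have hK0 : 0 ≤ K := by positivity
  have hcoordEps : ∀ j : ℕ, 10 * l / coordEps ε δ j = K * Real.sqrt (2 ^ j) := by
    intro j
    rw [hK, coordEps, pow_succ, mul_assoc ((2 : ℝ) ^ j), Real.sqrt_mul (by positivity)]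
    field_simp
    ring
  -- Counts may err by the selection threshold itself; for coordinates the tolerance is chosen so
  -- that each fails with probability at most 2e^{-9l}. Each family receives half of β.
  set x : Instance d → ℝ := fun t => match t with
    | (_, none) => θ
    | (j, some _) => 10 * l / coordEps ε δ j with hx
  have hx0 : ∀ t, 0 ≤ x t := by
    rintro ⟨j, _ | k⟩
    · exact hθ0
    · have := coordEps_pos hε hδ hδ1 (j : ℕ)
      change 0 ≤ 10 * l / coordEps ε δ j
      positivity
  have hfail : ∑ t, 2 * Real.exp (-(0.9 * instanceEps ε δ t * x t)) ≤ β := by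
    have h1 : ∀ j : Level d, 2 * Real.exp (-(0.9 * instanceEps (d := d) ε δ (j, none) * x (j, none))) =
        2 * Real.exp (-(1.17 * Real.logb 2 y)) := by
      intro j
      change 2 * Real.exp (-(0.9 * (ε / 2) * θ)) = _
      rw [hθeq]
      congr 3
      field_simp
      ring
    have h2 : ∀ (j : Level d) (k : Fin d),
        2 * Real.exp (-(0.9 * instanceEps ε δ (j, some k) * x (j, some k))) =
        2 * Real.exp (-(9 * l)) := by
      intro j k
      have := coordEps_pos hε hδ hδ1 (j : ℕ)
      change 2 * Real.exp (-(0.9 * coordEps ε δ j * (10 * l / coordEps ε δ j))) = _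
      congr 3
      field_simp
      ring
    rw [Fintype.sum_prod_type]
    simp only [Fintype.sum_option, h1, h2, Finset.sum_const, Finset.card_univ, Fintype.card_fin,
      nsmul_eq_mul]
    have e : 2 * ((Nat.clog 2 d : ℝ) + 1) = y * β := by rw [hy]; field_simp
    have hc := count_failure_le hβ.le hy4
    have hs := coord_failure_le hβ hβ1 hd'
    have hmul : ((Nat.clog 2 d : ℝ) + 1) * (d * (2 * Real.exp (-(9 * l)))) ≤
        d * d * (2 * Real.exp (-(9 * l))) := by
      rw [mul_assoc (d : ℝ)]
      gcongr
    push_cast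
    rw [mul_add, ← mul_assoc _ 2, mul_comm _ (2 : ℝ), e]
    linarith
  have hmain := sparVecView_accurate hn hε hδ hδ1 D hx0 hfail
  rw [sparVecSumDP, PMF.toOuterMeasure_map_apply]
  refine hmain.trans (MeasureTheory.measure_mono fun R hR k => ?_)
  refine (analyzer_error_le hθ0 hK0 rfl D (fun j => hR (j, none)) (fun j k => ?_) k).trans ?_
  · rw [← hcoordEps]
    exact hR (j, some k)
  have hmax := maxL2_nonneg D
  have hsl : 1 ≤ Real.sqrt lam := Real.one_le_sqrt.2 hlam1
  have hKle : K ≤ 40 * l * Real.sqrt lam / ε := by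
    have : Real.sqrt (2 * Real.logb 2 (2 / δ)) ≤ 2 * Real.sqrt lam := by
      rw [Real.sqrt_le_iff]
      refine ⟨by positivity, ?_⟩
      rw [mul_pow, Real.sq_sqrt (by linarith), hL]
      linarith
    rw [hK]
    calc _ ≤ 20 * l * (2 * Real.sqrt lam) / ε := by gcongr
      _ = _ := by ring
  have hθle : θ ≤ 5.2 * l * Real.sqrt lam / ε := by
    rw [hθeq, le_div_iff₀ hε]
    calc 1.3 * (2 / ε) * Real.logb 2 y * ε = 2.6 * Real.logb 2 y := by field_simp; norm_num
      _ ≤ 2.6 * (2 * l) := by gcongr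
      _ = 5.2 * l * 1 := by ring
      _ ≤ _ := by gcongr
  have hll : 0 ≤ Real.logb 2 (Real.logb 2 d) := by
    refine Real.logb_nonneg (by norm_num) ?_
    rw [Real.le_logb_iff_rpow_le (by norm_num) (by linarith)]
    norm_num; exact hd
  calc 6 * (K + 2 * θ) * maxL2 D
      ≤ 6 * (40 * l * Real.sqrt lam / ε + 2 * (5.2 * l * Real.sqrt lam / ε)) * maxL2 D := by
        gcongr
    -- Here 302.4 = 6(40 + 2·5.2). The log log d term is not needed: it is nonnegative and is simply
    -- added.
    _ = 302.4 * (maxL2 D * Real.sqrt lam * l / ε) := by ring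
    _ ≤ C * ((maxL2 D * Real.sqrt lam + Real.logb 2 (Real.logb 2 d)) * l / ε) := by
        gcongr
        · linarith
        · linarith

/-! ### The number of messages -/

theorem expectedMessages_mapHom_tagHom {d : ℕ} (t : Instance d) (P : PMF (Multiset ℤˣ)) :
    expectedMessages (mapHom (tagHom t) P) = expectedMessages P := by
  rw [expectedMessages_eq_mean, mapHom_apply, mean_map, expectedMessages_eq_mean]
  congr 1
  funext s
  simp [tagHom]

/-- Equivalent to e^s ≥ 1 + s. It turns the mean rp/(1-p) with p = e^{-s} into the bound r/s. -/
theorem exp_neg_div_le {s : ℝ} (hs : 0 < s) : Real.exp (-s) / (1 - Real.exp (-s)) ≤ 1 / s := by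
  have h := exp_neg_lt_one hs
  rw [div_le_div_iff₀ (by linarith) hs]
  have h1 := Real.add_one_le_exp s
  have h2 : Real.exp (-s) * Real.exp s = 1 := by rw [← Real.exp_add]; simp
  nlinarith [Real.exp_pos (-s)]

theorem expectedMessages_baseSumRandomizer_le {n : ℕ} (hn : 0 < n) {ε δ : ℝ} (hε : 0 < ε)
    (hδ : 0 < δ) (hδ1 : δ ≤ 1) (x : Bool) :
    expectedMessages (baseSumRandomizer n ε δ 0.1 x) ≤
      ENNReal.ofReal ((x.toNat : ℝ) + 101 * (3 * (1 + Real.log (1 / δ))) / (ε * n)) := by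
  have hR := three_le_noiseShape hδ hδ1
  have hn' : (0 : ℝ) < n := by exact_mod_cast hn
  have hp := exp_neg_lt_one (x := (1 - 0.1) * ε) (by linarith)
  have hq := exp_neg_lt_one (x := 0.2 * (0.1 * ε)) (by linarith)
  have hpb := exp_neg_div_le (s := (1 - 0.1) * ε) (by linarith)
  have hqb := exp_neg_div_le (s := 0.2 * (0.1 * ε)) (by linarith)
  have hcard : ∀ a b c : ℕ, ((Multiset.card (Multiset.replicate x.toNat (1 : ℤˣ) +
      Multiset.replicate (a + c) 1 + Multiset.replicate (b + c) (-1)) : ℕ) : ℝ≥0∞) =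
      (a : ℝ≥0∞) + ((b : ℝ≥0∞) + (((x.toNat : ℕ) : ℝ≥0∞) + ((c : ℝ≥0∞) + (c : ℝ≥0∞)))) := by
    intro a b c
    simp only [Multiset.card_add, Multiset.card_replicate]
    push_cast
    ring
  rw [expectedMessages_eq_mean, baseSumRandomizer]
  simp only [mean_bind, mean_pure, hcard, mean_add, mean_const]
  rw [mean_negBin (by positivity) (Real.exp_pos _).le hp,
    mean_negBin (by positivity) (Real.exp_pos _).le hq]
  generalize Real.exp (-((1 - 0.1) * ε)) = p at hp hpb
  generalize Real.exp (-(0.2 * (0.1 * ε))) = q at hq hqb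
  generalize 3 * (1 + Real.log (1 / δ)) = R at hR
  have h1 : 1 / (n : ℝ) * p / (1 - p) ≤ 1 / n * (1 / ((1 - 0.1) * ε)) := by
    rw [mul_div_assoc]; gcongr
  have h2 : R / n * q / (1 - q) ≤ R / n * (1 / (0.2 * (0.1 * ε))) := by
    rw [mul_div_assoc]; gcongr
  calc _ ≤ ENNReal.ofReal (1 / n * (1 / ((1 - 0.1) * ε))) +
        (ENNReal.ofReal (1 / n * (1 / ((1 - 0.1) * ε))) + (ENNReal.ofReal (x.toNat : ℝ) +
          (ENNReal.ofReal (R / n * (1 / (0.2 * (0.1 * ε)))) +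
            ENNReal.ofReal (R / n * (1 / (0.2 * (0.1 * ε))))))) := by
        rw [ENNReal.ofReal_natCast]
        gcongr
    _ = ENNReal.ofReal (1 / n * (1 / ((1 - 0.1) * ε)) + (1 / n * (1 / ((1 - 0.1) * ε)) +
          ((x.toNat : ℝ) + (R / n * (1 / (0.2 * (0.1 * ε))) +
            R / n * (1 / (0.2 * (0.1 * ε))))))) := by
        have i1 : 0 ≤ 1 / (n : ℝ) * (1 / ((1 - 0.1) * ε)) := by
          have : 0 < (1 - 0.1) * ε := by linarith
          positivity
        have i2 : 0 ≤ R / n * (1 / (0.2 * (0.1 * ε))) := by positivity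
        have i3 : (0 : ℝ) ≤ (x.toNat : ℝ) := by positivity
        rw [ENNReal.ofReal_add i1 (by linarith), ENNReal.ofReal_add i1 (by linarith),
          ENNReal.ofReal_add i3 (by linarith), ENNReal.ofReal_add i2 i2]
    _ ≤ _ := by
        refine ENNReal.ofReal_le_ofReal ?_
        have e1 : 1 / (n : ℝ) * (1 / ((1 - 0.1) * ε)) = 10 / 9 * (1 / (ε * n)) := by
          field_simp; norm_num
        have e2 : R / n * (1 / (0.2 * (0.1 * ε))) = 50 * R * (1 / (ε * n)) := by
          field_simp; norm_num
        rw [e1, e2, div_eq_mul_one_div (101 * R)]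
        have : 0 < 1 / (ε * n) := by positivity
        -- The noise amounts to (20/9 + 100R)/(εn), and 20/9 ≤ R because R ≥ 3.
        nlinarith

theorem clog_le_two_mul_logb {d : ℕ} (hd : 2 ≤ d) :
    (Nat.clog 2 d : ℝ) ≤ 2 * Real.logb 2 d ∧ (2 : ℝ) ^ Nat.clog 2 d ≤ 2 * d ∧
      1 ≤ Real.logb 2 d := by
  have hd' : (2 : ℝ) ≤ d := by exact_mod_cast hd
  have h1 : 1 ≤ Real.logb 2 d := by
    rw [Real.le_logb_iff_rpow_le (by norm_num) (by linarith)]; norm_num; exact hd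
  obtain ⟨c, hc⟩ := Nat.exists_eq_succ_of_ne_zero
    (Nat.clog_pos (b := 2) (by norm_num) (by omega : 1 < d)).ne'
  have h2 := Nat.pow_pred_clog_lt_self (b := 2) (by norm_num) (by omega : 1 < d)
  rw [hc, Nat.pred_succ] at h2
  have h3 : (2 : ℝ) ^ c ≤ d := by exact_mod_cast h2.le
  refine ⟨?_, ?_, h1⟩
  · have h4 : (c : ℝ) ≤ Real.logb 2 d := by
      rw [Real.le_logb_iff_rpow_le (by norm_num) (by linarith), Real.rpow_natCast]; exact h3
    rw [hc]; push_cast; linarith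
  · rw [hc, Nat.succ_eq_add_one, pow_succ]; linarith

theorem sum_instanceBit_le {d : ℕ} (x : BinVec d) :
    ∑ t : Instance d, ((instanceBit x t).toNat : ℝ) ≤ sparsity x + 1 := by
  rw [Fintype.sum_prod_type]
  simp only [Fintype.sum_option, Finset.sum_add_distrib]
  have h2 : ∑ j : Level d, ∑ k : Fin d, ((instanceBit x (j, some k)).toNat : ℝ) =
      sparsity x := by
    rw [Finset.sum_comm, sparsity]
    push_cast
    refine Finset.sum_congr rfl fun k _ => ?_
    exact_mod_cast (toNat_eq_sum_level x k).symm
  rw [h2, add_comm]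
  gcongr
  exact sum_inClass_cast_le_one x

theorem expectedMessages_sparVecRandomizer_le {n d : ℕ} (hn : 0 < n) (hd : 2 ≤ d) {ε δ : ℝ}
    (hε : 0 < ε) (hδ : 0 < δ) (hδ1 : δ ≤ 1 / 2) (x : BinVec d) :
    expectedMessages (sparVecRandomizer n d ε δ x) ≤ ENNReal.ofReal ((sparsity x : ℝ) + 1 +
      40000 * ((d : ℝ) ^ (3 / 2 : ℝ) * Real.logb 2 d * Real.logb 2 (1 / δ) ^ (3 / 2 : ℝ) /
        (ε * n))) := by
  have hn' : (0 : ℝ) < n := by exact_mod_cast hn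
  have hd' : (2 : ℝ) ≤ d := by exact_mod_cast hd
  obtain ⟨hm, hpow, hl1⟩ := clog_le_two_mul_logb hd
  have hmd : (Nat.clog 2 d : ℝ) + 1 ≤ d := by exact_mod_cast clog_add_one_le hd
  set l := Real.logb 2 d with hl
  set lam := Real.logb 2 (1 / δ) with hlam
  have hlam1 : 1 ≤ lam := by
    rw [hlam, Real.le_logb_iff_rpow_le (by norm_num) (by positivity), le_div_iff₀ hδ]
    norm_num; linarith
  have hL : Real.logb 2 (2 / δ) = 1 + lam := by
    rw [hlam, div_eq_mul_one_div, Real.logb_mul (by norm_num) (by positivity)]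
    simp
  have hln2 : Real.log 2 ≤ 1 := by linarith [Real.log_two_lt_d9]
  have hln2' : 0 ≤ Real.log 2 := (Real.log_pos (by norm_num)).le
  have hlog : Real.log (1 / δ) ≤ lam := by
    have h : Real.log (1 / δ) = lam * Real.log 2 := by
      rw [hlam, Real.logb, div_mul_cancel₀ _ (Real.log_pos (by norm_num)).ne']
    rw [h]; nlinarith
  have hrpow : ∀ y : ℝ, 0 < y → y ^ (3 / 2 : ℝ) = y * Real.sqrt y := fun y hy => by
    rw [show (3 / 2 : ℝ) = 1 + 1 / 2 by norm_num, Real.rpow_add hy, Real.rpow_one,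
      Real.sqrt_eq_rpow]
  have hsl : 1 ≤ Real.sqrt lam := Real.one_le_sqrt.2 hlam1
  have hsd : 1 ≤ Real.sqrt d := Real.one_le_sqrt.2 (by linarith)
  have hnoise : ∀ (t : Instance d), 0 ≤ 101 * (3 * (1 + Real.log (1 / instanceDelta δ t))) /
      (instanceEps ε δ t * n) := fun t => by
    have h1 := three_le_noiseShape (instanceDelta_pos hδ t)
      ((instanceDelta_le hδ1 t).trans (by norm_num))
    have h2 := instanceEps_pos hε hδ hδ1 t
    positivity
  have hcount : ∀ j : Level d, 101 * (3 * (1 + Real.log (1 / instanceDelta (d := d) δ (j, none)))) /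
      (instanceEps (d := d) ε δ (j, none) * n) ≤ 1818 * lam / (ε * n) := by
    intro j
    change 101 * (3 * (1 + Real.log (1 / (δ / 2)))) / (ε / 2 * n) ≤ _
    have h : Real.log (1 / (δ / 2)) = Real.log 2 + Real.log (1 / δ) := by
      rw [← Real.log_mul (by norm_num) (by positivity)]; congr 1; field_simp
    rw [h, div_le_div_iff₀ (by positivity) (by positivity)]
    have h2 : 101 * (3 * (1 + (Real.log 2 + Real.log (1 / δ)))) * 2 ≤ 1818 * lam := by linarith
    calc _ = 101 * (3 * (1 + (Real.log 2 + Real.log (1 / δ)))) * 2 * (ε / 2 * n) := by ring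
      _ ≤ _ := by gcongr
  have hcoord : ∀ (j : Level d) (k : Fin d),
      101 * (3 * (1 + Real.log (1 / instanceDelta δ (j, some k)))) /
        (instanceEps ε δ (j, some k) * n) ≤
        6060 * l * lam * Real.sqrt lam / (ε * n) * Real.sqrt (2 ^ (j : ℕ)) := by
    intro j k
    have hj : (j : ℝ) ≤ 2 * l := by
      refine le_trans ?_ hm
      exact_mod_cast Nat.lt_succ_iff.1 j.2
    have h1 : Real.log (1 / coordDelta δ j) ≤ 2 * l + 1 + lam := by
      have : Real.log (1 / coordDelta δ j) = ((j : ℝ) + 1) * Real.log 2 + Real.log (1 / δ) := by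
        have e : 1 / coordDelta δ j = 2 ^ ((j : ℕ) + 1) * (1 / δ) := by
          rw [coordDelta]; field_simp
        rw [e, Real.log_mul (by positivity) (by positivity), Real.log_pow]
        push_cast; rfl
      rw [this]
      have : ((j : ℝ) + 1) * Real.log 2 ≤ (j : ℝ) + 1 :=
        mul_le_of_le_one_right (by positivity) hln2
      linarith
    have h2 : 101 * (3 * (1 + Real.log (1 / coordDelta δ j))) ≤ 1515 * (l * lam) := by
      nlinarith [mul_nonneg (sub_nonneg.2 hl1) (sub_nonneg.2 hlam1)]
    have h3 : 1 / coordEps ε δ j ≤ 4 * Real.sqrt lam * Real.sqrt (2 ^ (j : ℕ)) / ε := by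
      rw [coordEps, one_div_div, pow_succ, mul_assoc ((2 : ℝ) ^ (j : ℕ)),
        Real.sqrt_mul (by positivity)]
      have : Real.sqrt (2 * Real.logb 2 (2 / δ)) ≤ 2 * Real.sqrt lam := by
        rw [Real.sqrt_le_iff]
        refine ⟨by positivity, ?_⟩
        rw [mul_pow, Real.sq_sqrt (by linarith), hL]
        linarith
      calc _ ≤ 2 * (Real.sqrt (2 ^ (j : ℕ)) * (2 * Real.sqrt lam)) / ε := by gcongr
        _ = _ := by ring
    have hpos := coordEps_pos hε hδ hδ1 (j : ℕ)
    change 101 * (3 * (1 + Real.log (1 / coordDelta δ j))) / (coordEps ε δ j * n) ≤ _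
    calc 101 * (3 * (1 + Real.log (1 / coordDelta δ j))) / (coordEps ε δ j * n)
        = 101 * (3 * (1 + Real.log (1 / coordDelta δ j))) * (1 / coordEps ε δ j) / n := by
          field_simp
      _ ≤ 1515 * (l * lam) * (4 * Real.sqrt lam * Real.sqrt (2 ^ (j : ℕ)) / ε) / n := by gcongr
      _ = _ := by field_simp; ring
  have htotal : ∑ t : Instance d, 101 * (3 * (1 + Real.log (1 / instanceDelta δ t))) /
      (instanceEps ε δ t * n) ≤
      40000 * ((d : ℝ) ^ (3 / 2 : ℝ) * l * lam ^ (3 / 2 : ℝ) / (ε * n)) := by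
    rw [hrpow d (by linarith), hrpow lam (by linarith), Fintype.sum_prod_type]
    simp only [Fintype.sum_option, Finset.sum_add_distrib]
    have hA : ∑ j : Level d, 101 * (3 * (1 + Real.log (1 / instanceDelta (d := d) δ (j, none)))) /
        (instanceEps (d := d) ε δ (j, none) * n) ≤
        1818 * (d * Real.sqrt d * l * (lam * Real.sqrt lam) / (ε * n)) := by
      calc _ ≤ ∑ _j : Level d, 1818 * lam / (ε * n) := Finset.sum_le_sum fun j _ => hcount j
        _ = ((Nat.clog 2 d : ℝ) + 1) * (1818 * lam / (ε * n)) := by simp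
        _ ≤ d * (1818 * lam / (ε * n)) := by gcongr
        _ = 1818 * (d * 1 * 1 * (lam * 1) / (ε * n)) := by ring
        _ ≤ _ := by gcongr
    have hB : ∑ j : Level d, ∑ k : Fin d,
        101 * (3 * (1 + Real.log (1 / instanceDelta δ (j, some k)))) /
          (instanceEps ε δ (j, some k) * n) ≤
        36360 * (d * Real.sqrt d * l * (lam * Real.sqrt lam) / (ε * n)) := by
      -- The classes contribute 4√(2^m) ≤ 4√(2d) ≤ 6√d. This is the source of the exponent 3/2 of d
      -- without an additional factor for the number of classes.
      have hs : ∑ j : Level d, Real.sqrt (2 ^ (j : ℕ)) ≤ 6 * Real.sqrt d := by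
        rw [Fin.sum_univ_eq_sum_range (fun j => Real.sqrt (2 ^ j))]
        refine (sum_sqrt_pow_le _).trans ?_
        calc 4 * Real.sqrt (2 ^ Nat.clog 2 d) ≤ 4 * Real.sqrt (1.5 ^ 2 * d) := by
              gcongr; linarith
          _ = 6 * Real.sqrt d := by
              rw [Real.sqrt_mul (by norm_num), Real.sqrt_sq (by norm_num)]; ring
      calc _ ≤ ∑ j : Level d, ∑ _k : Fin d,
            6060 * l * lam * Real.sqrt lam / (ε * n) * Real.sqrt (2 ^ (j : ℕ)) :=
            Finset.sum_le_sum fun j _ => Finset.sum_le_sum fun k _ => hcoord j k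
        _ = d * (6060 * l * lam * Real.sqrt lam / (ε * n)) *
              ∑ j : Level d, Real.sqrt (2 ^ (j : ℕ)) := by
            simp only [Finset.sum_const, Finset.card_univ, Fintype.card_fin, nsmul_eq_mul]
            rw [Finset.mul_sum]
            exact Finset.sum_congr rfl fun j _ => by ring
        _ ≤ d * (6060 * l * lam * Real.sqrt lam / (ε * n)) * (6 * Real.sqrt d) := by gcongr
        _ = _ := by ring
    have hX : 0 ≤ d * Real.sqrt d * l * (lam * Real.sqrt lam) / (ε * n) := by positivity
    linarith
  rw [sparVecRandomizer_eq, expectedMessages_prod]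
  simp only [expectedMessages_mapHom_tagHom]
  calc _ ≤ ∑ t : Instance d, ENNReal.ofReal (((instanceBit x t).toNat : ℝ) +
          101 * (3 * (1 + Real.log (1 / instanceDelta δ t))) / (instanceEps ε δ t * n)) :=
        Finset.sum_le_sum fun t _ => expectedMessages_baseSumRandomizer_le hn
          (instanceEps_pos hε hδ hδ1 t) (instanceDelta_pos hδ t)
          ((instanceDelta_le hδ1 t).trans (by norm_num)) _
    _ = ENNReal.ofReal (∑ t : Instance d, (((instanceBit x t).toNat : ℝ) +
          101 * (3 * (1 + Real.log (1 / instanceDelta δ t))) / (instanceEps ε δ t * n))) :=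
        (ENNReal.ofReal_sum_of_nonneg fun t _ => add_nonneg (by positivity) (hnoise t)).symm
    _ ≤ _ := by
        refine ENNReal.ofReal_le_ofReal ?_
        rw [Finset.sum_add_distrib]
        exact add_le_add (sum_instanceBit_le x) htotal

/-- Messages have short injective encodings. -/
theorem exists_code {d : ℕ} (hd : 2 ≤ d) :
    ∃ b : ℕ, (b : ℝ) ≤ 8 * Real.logb 2 d ∧
      ∃ code : Message d → Fin b → Bool, Function.Injective code := by
  refine ⟨4 * Nat.clog 2 d, ?_, ?_⟩
  · push_cast
    linarith [(clog_le_two_mul_logb hd).1]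
  · have hcard : Fintype.card (Message d) ≤ Fintype.card (Fin (4 * Nat.clog 2 d) → Bool) := by
      have h1 := clog_add_one_le hd
      have h2 := Nat.le_pow_clog (b := 2) (by norm_num) d
      simp only [Fintype.card_prod, Fintype.card_fin, Fintype.card_option, Fintype.card_fun,
        Fintype.card_bool, Fintype.card_units_int]
      calc (Nat.clog 2 d + 1) * (d + 1) * 2 ≤ d * (d + 1) * 2 := by gcongr
        _ ≤ d ^ 4 := by nlinarith [mul_le_mul hd hd (by norm_num) (by omega), pow_pos (by omega : 0 < d) 3]
        _ ≤ (2 ^ Nat.clog 2 d) ^ 4 := by gcongr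
        _ = 2 ^ (4 * Nat.clog 2 d) := by rw [← pow_mul, mul_comm]
    obtain ⟨f⟩ := Function.Embedding.nonempty_of_card_le hcard
    exact ⟨f, f.injective⟩

end SparVec

end

open SparVec in
theorem mainTheorem3 :
    ∃ C : ℝ, 0 < C ∧ ∀ (n d : ℕ) (ε δ : ℝ), 0 < n → 2 ≤ d → 0 < ε → 0 < δ → δ ≤ 1 / 2 →
      (ε ≤ 10 →
        IsDP RemoveNeighbour (sparVecView n d ε δ) ε δ ∧
        IsDP ReplaceNeighbour (sparVecView n d ε δ) (2 * ε) (2 * δ)) ∧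
      (∀ β : ℝ, 0 < β → β < 1 → ∀ D : Fin n → BinVec d,
        ENNReal.ofReal (1 - β) ≤
          (sparVecSumDP n d ε δ β D).toOuterMeasure
            {y | ∀ k : Fin d, |(y k : ℝ) - ∑ i, ((D i k).toNat : ℝ)| ≤
              C * ((maxL2 D * Real.sqrt (Real.logb 2 (1 / δ)) + Real.logb 2 (Real.logb 2 d)) *
                Real.logb 2 (d / β) / ε)}) ∧
      (∀ x : BinVec d,
        expectedMessages (sparVecRandomizer n d ε δ x) ≤
          ENNReal.ofReal ((sparsity x : ℝ) + 1 +
            C * ((d : ℝ) ^ (3 / 2 : ℝ) * Real.logb 2 d * Real.logb 2 (1 / δ) ^ (3 / 2 : ℝ) /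
              (ε * n)))) ∧
      (∃ b : ℕ, (b : ℝ) ≤ C * Real.logb 2 d ∧
        ∃ code : Message d → Fin b → Bool, Function.Injective code) := by
  -- The message count dictates the constant (1818 + 36360); accuracy needs 400 and the encoding
  -- needs 8.
  refine ⟨40000, by norm_num, fun n d ε δ hn hd hε hδ hδ1 => ⟨fun hε1 => ?_, ?_, ?_, ?_⟩⟩
  · exact ⟨isDP_remove hn hε hε1 hδ hδ1, isDP_replace hn hε hε1 hδ hδ1⟩
  · exact fun β hβ hβ1 D => sparVecSumDP_accuracy hn hd hε hδ hδ1 hβ hβ1 (by norm_num) D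
  · exact fun x => expectedMessages_sparVecRandomizer_le hn hd hε hδ hδ1 x
  · obtain ⟨b, hb, hcode⟩ := exists_code hd
    exact ⟨b, hb.trans (by linarith [(clog_le_two_mul_logb hd).2.2]), hcode⟩
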